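/- Let $\mathfrak g$ be a finite-dimensional complex semisimple Lie algebra with Cartan subalgebra $\mathfrak h$, simple roots $\Pi^+$, root lattice cone $\Gamma_+=\mathbb Z_{\ge 0}\Pi^+$, and let $(\cdot,\cdot)$ be the form on $\mathfrak h^*$ induced by a positive rational multiple of the Killing form. Let $q=e^{\hbar}$ not be a root of unity and put $q^x=e^{\hbar x}$ for $x\in\mathbb C$. Let $U_q(\mathfrak g)$ be the quantum group with generators $e_\alpha,f_\alpha,q^{\pm h_\alpha}$ ($\alpha\in\Pi^+$), where the $q^{\pm h_\alpha}$ commute and $q^{h_\alpha}q^{-h_\alpha}=1$, $q^{h_\alpha}e_\beta=q^{(\alpha,\beta)}e_\beta q^{h_\alpha}$, $q^{h_\alpha}f_\beta=q^{-(\alpha,\beta)}f_\beta q^{h_\alpha}$, $[e_\alpha,f_\beta]=\delta_{\alpha\beta}\frac{q^{h_\alpha}-q^{-h_\alpha}}{q-q^{-1}}$, together with the quantum Serre relations (with parameter $q_\alpha=q^{(\alpha,\alpha)/2}$). It acts on tensor products through $\Delta(e_\alpha)=e_\alpha\otimes q^{h_\alpha}+1\otimes e_\alpha$, $\Delta(f_\alpha)=f_\alpha\otimes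 1+q^{-h_\alpha}\otimes f_\alpha$, $\Delta(q^{\pm h_\alpha})=q^{\pm h_\alpha}\otimes q^{\pm h_\alpha}$. Let $\gamma$ be the antipode, so that $\gamma^{-1}$ is the anti-automorphism with $\gamma^{-1}(e_\alpha)=-q^{-h_\alpha}e_\alpha$, $\gamma^{-1}(f_\alpha)=-f_\alpha q^{h_\alpha}$, $\gamma^{-1}(q^{\pm h_\alpha})=q^{\mp h_\alpha}$; let $\sigma$ be the algebra automorphism $e_\alpha\leftrightarrow f_\alpha$, $q^{h_\alpha}\mapsto q^{-h_\alpha}$, and $\omega=\gamma^{-1}\circ\sigma$. Let $U_q(\mathfrak g_-)$ be the subalgebra generated by the $f_\alpha$. A vector $v$ of a module has weight $\mu\in\mathfrak h^*$ if $q^{h_\alpha}v=q^{(\alpha,\mu)}v$ for all $\alpha$; a singular vector is a non-zero weight vector killed by all $e_\alpha$. Let $V$ and $Z$ be irreducible highest weight $U_q(\mathfrak g)$-modules, let $\zeta$ be the highest weight of $Z$ and $1_\zeta\in Z$ a highest vector, and let $\hat M_\zeta$ be the Verma module of highest weight $\zeta$, its highest vector also denoted by $1_\zeta$. For $M\in\{Z,\hat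 M_\zeta\}$ let $(V\otimes M)^+$ be the span of the singular vectors of $V\otimes M$; the leading coefficient of $u\in V\otimes M$ is the $v\in V$ such that $u-v\otimes 1_\zeta\in \sum_{\beta\in\Gamma_+\setminus\{0\}} V\otimes M[\zeta-\beta]$. Let $I^-_Z\subset U_q(\mathfrak g_-)$ be the annihilator of $1_\zeta\in Z$, $I^+_Z=\sigma(I^-_Z)$, $V^+_Z=\{v\in V: I_Z^+v=0\}$, $V^\perp_Z=\omega(I^+_Z)V$ and ${}^+V_Z=V/V_Z^\perp$. Let $V^+_\zeta\subset V$ be the span of the leading coefficients of the singular vectors of $V\otimes\hat M_\zeta$. For $v\in V^+_Z$ (respectively $v\in V^+_\zeta$) choose $u\in(V\otimes Z)^+$ (respectively $u\in (V\otimes\hat M_\zeta)^+$) with leading coefficient $v$, write $u=\sum_i v_i\otimes f_i1_\zeta$ with $v_i\in V$, $f_i\in U_q(\mathfrak g_-)$, and let $\theta_{V,Z}(v)$ (respectively $\theta_{V,\hat M_\zeta}(v)$) be the class of $\sum_i\gamma^{-1}(f_i)v_i$ in ${}^+V_Z$. Suppose that every singular vector of $V\otimes Z$ is the image of a singular vector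 of $V\otimes\hat M_\zeta$ under the map induced by the projection $\hat M_\zeta\to Z$, $1_\zeta\mapsto 1_\zeta$. Then $V^+_Z=V^+_\zeta$, both recipes give well-defined linear maps $\theta_{V,Z}\colon V^+_Z\to{}^+V_Z$ and $\theta_{V,\hat M_\zeta}\colon V^+_\zeta\to{}^+V_Z$ (the required $u$ and presentations exist, and the values do not depend on the choices), and $\theta_{V,Z}=\theta_{V,\hat M_\zeta}$. -/

import Mathlib

open scoped TensorProduct

namespace QuantumTwist

noncomputable section

/-! ### Root data of a complex semisimple Lie algebra

`b` is a base of the root system of `𝔤` with respect to the Cartan subalgebra `H`; the simple roots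
are indexed by `b.support`. -/

section RootData

variable {𝔤 : Type*} [LieRing 𝔤] [LieAlgebra ℂ 𝔤] [FiniteDimensional ℂ 𝔤]
  [LieAlgebra.IsKilling ℂ 𝔤] {H : LieSubalgebra ℂ 𝔤} [H.IsCartanSubalgebra]

/-- The vector `h_lam` of the Cartan subalgebra that represents the functional `lam` with respect
to the form `c • (Killing form)`. -/
def hvec (c : ℚ) (lam : Module.Dual ℂ H) : H :=
  (c : ℂ)⁻¹ • (LieAlgebra.IsKilling.cartanEquivDual H).symm lam

/-- The form `(lam, mu)` on the dual of the Cartan subalgebra that is transferred from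
`c • (Killing form)`, that is, `(lam, mu) = mu (h_lam)`. -/
def form (c : ℚ) (lam mu : Module.Dual ℂ H) : ℂ := mu (hvec c lam)

theorem form_comm (c : ℚ) (lam mu : Module.Dual ℂ H) : form c lam mu = form c mu lam := by
  have key : ∀ x y : Module.Dual ℂ H, form c x y = (c : ℂ)⁻¹ * LieModule.traceForm ℂ H 𝔤
      ((LieAlgebra.IsKilling.cartanEquivDual H).symm y)
      ((LieAlgebra.IsKilling.cartanEquivDual H).symm x) := by
    intro x y
    have h : LieModule.traceForm ℂ H 𝔤
        ((LieAlgebra.IsKilling.cartanEquivDual H).symm y)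
        ((LieAlgebra.IsKilling.cartanEquivDual H).symm x) =
        LieAlgebra.IsKilling.cartanEquivDual H ((LieAlgebra.IsKilling.cartanEquivDual H).symm y)
        ((LieAlgebra.IsKilling.cartanEquivDual H).symm x) := rfl
    rw [h, LinearEquiv.apply_symm_apply]
    simp [form, hvec]
  rw [key, key, LieModule.traceForm_comm]

variable (b : (LieAlgebra.IsKilling.rootSystem H).Base)

/-- The simple roots. -/
def simpleRoot (i : b.support) : Module.Dual ℂ H := (LieAlgebra.IsKilling.rootSystem H).root i

/-- The monoid of sums of simple roots with non-negative integer coefficients. -/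
def posCone : AddSubmonoid (Module.Dual ℂ H) := AddSubmonoid.closure (Set.range (simpleRoot b))

end RootData

/-! ### Quantum integers, for `q = exp ħ` and complex powers `q ^ x = exp (ħ x)` -/

/-- `q ^ x`. -/
def qpow (ħ x : ℂ) : ℂ := Complex.exp (ħ * x)

/-- The quantum integer `[n]` in the parameter `p`. -/
def qInt (p : ℂ) (n : ℕ) : ℂ := (p ^ n - p⁻¹ ^ n) / (p - p⁻¹)

/-- The quantum factorial. -/
def qFactorial (p : ℂ) (n : ℕ) : ℂ := ∏ k ∈ Finset.range n, qInt p (k + 1)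

/-- The (symmetric) quantum binomial coefficient. -/
def qBinom (p : ℂ) (n k : ℕ) : ℂ := qFactorial p n / (qFactorial p k * qFactorial p (n - k))

/-- The quantum Serre polynomial
`∑ k, (-1)^k [n choose k] x^(n-k) y x^k` in the parameter `p`. -/
def serre {A : Type*} [Ring A] [Algebra ℂ A] (p : ℂ) (n : ℕ) (x y : A) : A :=
  ∑ k ∈ Finset.range (n + 1), ((-1) ^ k * qBinom p n k) • (x ^ (n - k) * y * x ^ k)

theorem map_serre {A B : Type*} [Ring A] [Algebra ℂ A] [Ring B] [Algebra ℂ B] (g : A →ₐ[ℂ] B)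
    (p : ℂ) (n : ℕ) (x y : A) : g (serre p n x y) = serre p n (g x) (g y) := by
  simp [serre, map_sum]

theorem unop_serre {A : Type*} [Ring A] [Algebra ℂ A] (p : ℂ) (n : ℕ) (x y : Aᵐᵒᵖ) :
    (serre p n x y).unop = ((-1 : ℂ) ^ n) • serre p n x.unop y.unop := by
  unfold serre
  rw [← Finset.sum_range_reflect, Finset.unop_sum, Finset.smul_sum]
  refine Finset.sum_congr rfl fun k hk => ?_
  have hk' : k ≤ n := Nat.lt_succ_iff.mp (Finset.mem_range.mp hk)
  have e1 : n + 1 - 1 - k = n - k := by omega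
  have e2 : n - (n - k) = k := by omega
  have e3 : qBinom p n (n - k) = qBinom p n k := by
    unfold qBinom; rw [e2, mul_comm (qFactorial p (n - k))]
  have e4 : (-1 : ℂ) ^ (n - k) = (-1) ^ n * (-1) ^ k := by
    obtain ⟨m, rfl⟩ := Nat.exists_eq_add_of_le hk'
    have h1 : (-1 : ℂ) ^ k * (-1) ^ k = 1 := by rw [← mul_pow]; simp
    rw [Nat.add_sub_cancel_left, pow_add]
    linear_combination (-(-1 : ℂ) ^ m) * h1
  rw [e1, e2, e3, e4, smul_smul]
  simp [mul_assoc]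

theorem qserre_pow {A : Type*} [Ring A] [Algebra ℂ A] (x y K L : A) (s t : ℂ)
    (h1 : K * x = s • (x * K)) (h2 : K * y = t • (y * K)) (h3 : L * x = t • (x * L))
    (h4 : L * K = K * L) (k m : ℕ) :
    (x * K) ^ k * (y * L) * (x * K) ^ m =
      (s ^ (k + m).choose 2 * t ^ (k + m)) • (x ^ k * y * x ^ m * (K ^ (k + m) * L)) := by
  have kx : ∀ n : ℕ, K ^ n * x = s ^ n • (x * K ^ n) := by
    intro n
    induction n with
    | zero => simp
    | succ n ih =>
      rw [pow_succ', mul_assoc, ih, mul_smul_comm, ← mul_assoc, h1, smul_mul_assoc, smul_smul,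
        mul_assoc, ← pow_succ]
  have xk : ∀ n : ℕ, K * x ^ n = s ^ n • (x ^ n * K) := by
    intro n
    induction n with
    | zero => simp
    | succ n ih =>
      rw [pow_succ, ← mul_assoc, ih, smul_mul_assoc, mul_assoc, h1, mul_smul_comm, smul_smul,
        ← mul_assoc, ← pow_succ]
  have choose_succ : ∀ n : ℕ, (n + 1).choose 2 = n.choose 2 + n := by
    intro n
    rw [Nat.choose_succ_succ' n 1, Nat.choose_one_right, add_comm]
  induction k with
  | zero =>
    induction m with
    | zero => simp
    | succ m ih =>
      simp only [pow_zero, one_mul, zero_add] at ih ⊢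
      rw [pow_succ, ← mul_assoc, ih, choose_succ, smul_mul_assoc]
      have : y * x ^ m * (K ^ m * L) * (x * K) =
          (t * s ^ m) • (y * x ^ (m + 1) * (K ^ (m + 1) * L)) := by
        calc y * x ^ m * (K ^ m * L) * (x * K)
            = y * x ^ m * (K ^ m * (L * x) * K) := by simp only [mul_assoc]
          _ = t • (y * x ^ m * (K ^ m * x * (L * K))) := by
              rw [h3]; simp only [mul_smul_comm, smul_mul_assoc, mul_assoc]
          _ = (t * s ^ m) • (y * x ^ m * (x * K ^ m * (L * K))) := by
              rw [kx, smul_mul_assoc, mul_smul_comm, smul_smul]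
          _ = _ := by rw [h4, pow_succ x, pow_succ K]; simp only [mul_assoc]
      rw [this, smul_smul]
      congr 1
      ring
  | succ k ih =>
    have e : k + 1 + m = (k + m) + 1 := by omega
    rw [pow_succ', mul_assoc, mul_assoc, ← mul_assoc ((x * K) ^ k), ih, e, choose_succ,
      mul_smul_comm]
    have : x * K * (x ^ k * y * x ^ m * (K ^ (k + m) * L)) =
        (s ^ (k + m) * t) • (x ^ (k + 1) * y * x ^ m * (K ^ (k + m + 1) * L)) := by
      calc x * K * (x ^ k * y * x ^ m * (K ^ (k + m) * L))
          = x * (K * x ^ k) * (y * x ^ m * (K ^ (k + m) * L)) := by simp only [mul_assoc]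
        _ = s ^ k • (x * x ^ k * (K * y) * (x ^ m * (K ^ (k + m) * L))) := by
            rw [xk]; simp only [mul_smul_comm, smul_mul_assoc, mul_assoc]
        _ = (s ^ k * t) • (x * x ^ k * y * (K * x ^ m) * (K ^ (k + m) * L)) := by
            rw [h2]; simp only [mul_smul_comm, smul_mul_assoc, mul_assoc, smul_smul]
        _ = (s ^ k * t * s ^ m) • (x * x ^ k * y * x ^ m * (K * K ^ (k + m) * L)) := by
            rw [xk]; simp only [mul_smul_comm, smul_mul_assoc, mul_assoc, smul_smul]
        _ = _ := by
            rw [← pow_succ', ← pow_succ' K]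
            congr 1
            ring
    rw [this, smul_smul]
    congr 1
    ring

/-- If `x, y` satisfy a quantum Serre relation, then so do the multiples of `x K`, `y L`. -/
theorem serre_twist {A : Type*} [Ring A] [Algebra ℂ A] (x y K L : A) (s t u v p : ℂ) (n : ℕ)
    (h1 : K * x = s • (x * K)) (h2 : K * y = t • (y * K)) (h3 : L * x = t • (x * L))
    (h4 : L * K = K * L) (h : serre p n x y = 0) :
    serre p n (u • (x * K)) (v • (y * L)) = 0 := by
  have : serre p n (u • (x * K)) (v • (y * L)) =
      (u ^ n * v * (s ^ n.choose 2 * t ^ n)) • (serre p n x y * (K ^ n * L)) := by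
    unfold serre
    rw [Finset.sum_mul, Finset.smul_sum]
    refine Finset.sum_congr rfl fun k hk => ?_
    have hk' : k ≤ n := Nat.lt_succ_iff.mp (Finset.mem_range.mp hk)
    have e : n - k + k = n := by omega
    have e' : u ^ n = u ^ (n - k) * u ^ k := by rw [← pow_add, e]
    have := qserre_pow x y K L s t h1 h2 h3 h4 (n - k) k
    rw [e] at this
    simp only [smul_pow, smul_mul_assoc, mul_smul_comm, smul_smul, this]
    congr 1
    rw [e']
    ring
  rw [this, h]
  simp

/-! ### The quantum group -/

section QuantumGroup

variable {𝔤 : Type*} [LieRing 𝔤] [LieAlgebra ℂ 𝔤] [FiniteDimensional ℂ 𝔤]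
  [LieAlgebra.IsKilling ℂ 𝔤] {H : LieSubalgebra ℂ 𝔤} [H.IsCartanSubalgebra]

/-- Labels of the generators `e_α`, `f_α`, `q^{h_α}`, `q^{-h_α}`. -/
inductive Gen (ι : Type*) where
  | e (i : ι) : Gen ι
  | f (i : ι) : Gen ι
  | K (i : ι) : Gen ι
  | Kinv (i : ι) : Gen ι

variable (b : (LieAlgebra.IsKilling.rootSystem H).Base) (c : ℚ) (ħ : ℂ)

/-- `(α_i, α_j)` for simple roots. -/
def gram (i j : b.support) : ℂ := form c (simpleRoot b i) (simpleRoot b j)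

theorem gram_comm (i j : b.support) : gram b c i j = gram b c j i := form_comm _ _ _

/-- `q_i = q ^ ((α_i, α_i) / 2)`. -/
def qi (i : b.support) : ℂ := qpow ħ (gram b c i i / 2)

/-- The exponent `1 - 2 (α_i, α_j) / (α_i, α_i)` of the Serre relation. -/
def serreExp (i j : b.support) : ℕ := (1 - b.cartanMatrix j i).toNat

/-- The defining relations of the quantum group, with `q = exp ħ`. -/
inductive Rel : FreeAlgebra ℂ (Gen b.support) → FreeAlgebra ℂ (Gen b.support) → Prop
  | K_Kinv (i : b.support) :
      Rel (FreeAlgebra.ι ℂ (Gen.K i) * FreeAlgebra.ι ℂ (Gen.Kinv i)) 1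
  | Kinv_K (i : b.support) :
      Rel (FreeAlgebra.ι ℂ (Gen.Kinv i) * FreeAlgebra.ι ℂ (Gen.K i)) 1
  | K_K (i j : b.support) :
      Rel (FreeAlgebra.ι ℂ (Gen.K i) * FreeAlgebra.ι ℂ (Gen.K j))
        (FreeAlgebra.ι ℂ (Gen.K j) * FreeAlgebra.ι ℂ (Gen.K i))
  | K_e (i j : b.support) :
      Rel (FreeAlgebra.ι ℂ (Gen.K i) * FreeAlgebra.ι ℂ (Gen.e j))
        (qpow ħ (gram b c i j) • (FreeAlgebra.ι ℂ (Gen.e j) * FreeAlgebra.ι ℂ (Gen.K i)))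
  | K_f (i j : b.support) :
      Rel (FreeAlgebra.ι ℂ (Gen.K i) * FreeAlgebra.ι ℂ (Gen.f j))
        (qpow ħ (-gram b c i j) • (FreeAlgebra.ι ℂ (Gen.f j) * FreeAlgebra.ι ℂ (Gen.K i)))
  | e_f_same (i : b.support) :
      Rel (FreeAlgebra.ι ℂ (Gen.e i) * FreeAlgebra.ι ℂ (Gen.f i)
          - FreeAlgebra.ι ℂ (Gen.f i) * FreeAlgebra.ι ℂ (Gen.e i))
        ((Complex.exp ħ - (Complex.exp ħ)⁻¹)⁻¹ •
          (FreeAlgebra.ι ℂ (Gen.K i) - FreeAlgebra.ι ℂ (Gen.Kinv i)))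
  | e_f_ne (i j : b.support) (hij : i ≠ j) :
      Rel (FreeAlgebra.ι ℂ (Gen.e i) * FreeAlgebra.ι ℂ (Gen.f j)
          - FreeAlgebra.ι ℂ (Gen.f j) * FreeAlgebra.ι ℂ (Gen.e i)) 0
  | serre_e (i j : b.support) (hij : i ≠ j) :
      Rel (serre (qi b c ħ i) (serreExp b i j)
        (FreeAlgebra.ι ℂ (Gen.e i)) (FreeAlgebra.ι ℂ (Gen.e j))) 0
  | serre_f (i j : b.support) (hij : i ≠ j) :
      Rel (serre (qi b c ħ i) (serreExp b i j)
        (FreeAlgebra.ι ℂ (Gen.f i)) (FreeAlgebra.ι ℂ (Gen.f j))) 0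

/-- The quantum group `U_q(𝔤)`, `q = exp ħ`. -/
def Uq : Type _ := RingQuot (Rel b c ħ)

instance : Ring (Uq b c ħ) := inferInstanceAs (Ring (RingQuot (Rel b c ħ)))

instance : Algebra ℂ (Uq b c ħ) := inferInstanceAs (Algebra ℂ (RingQuot (Rel b c ħ)))

/-- The quotient map from the free algebra. -/
def quot : FreeAlgebra ℂ (Gen b.support) →ₐ[ℂ] Uq b c ħ := RingQuot.mkAlgHom ℂ (Rel b c ħ)

variable {b}

/-- The generator `e_α`. -/
def genE (i : b.support) : Uq b c ħ := quot b c ħ (FreeAlgebra.ι ℂ (Gen.e i))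

/-- The generator `f_α`. -/
def genF (i : b.support) : Uq b c ħ := quot b c ħ (FreeAlgebra.ι ℂ (Gen.f i))

/-- The generator `q^{h_α}`. -/
def genK (i : b.support) : Uq b c ħ := quot b c ħ (FreeAlgebra.ι ℂ (Gen.K i))

/-- The generator `q^{-h_α}`. -/
def genKinv (i : b.support) : Uq b c ħ := quot b c ħ (FreeAlgebra.ι ℂ (Gen.Kinv i))

theorem quot_rel {x y : FreeAlgebra ℂ (Gen b.support)} (h : Rel b c ħ x y) :
    quot b c ħ x = quot b c ħ y := RingQuot.mkAlgHom_rel ℂ h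

/-- The homomorphism induced by a homomorphism of the free algebra that respects the relations. -/
def liftHom {A : Type*} [Ring A] [Algebra ℂ A] (g : FreeAlgebra ℂ (Gen b.support) →ₐ[ℂ] A)
    (hg : ∀ ⦃x y⦄, Rel b c ħ x y → g x = g y) : Uq b c ħ →ₐ[ℂ] A :=
  RingQuot.liftAlgHom ℂ (s := Rel b c ħ) ⟨g, hg⟩

theorem liftHom_quot {A : Type*} [Ring A] [Algebra ℂ A]
    (g : FreeAlgebra ℂ (Gen b.support) →ₐ[ℂ] A) (hg : ∀ ⦃x y⦄, Rel b c ħ x y → g x = g y)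
    (x : FreeAlgebra ℂ (Gen b.support)) : liftHom c ħ g hg (quot b c ħ x) = g x :=
  RingQuot.liftAlgHom_mkAlgHom_apply ℂ g hg x

theorem K_mul_Kinv (i : b.support) : genK c ħ i * genKinv c ħ i = 1 := by
  simpa [genK, genKinv] using quot_rel c ħ (Rel.K_Kinv i)

theorem Kinv_mul_K (i : b.support) : genKinv c ħ i * genK c ħ i = 1 := by
  simpa [genK, genKinv] using quot_rel c ħ (Rel.Kinv_K i)

theorem K_mul_K (i j : b.support) : genK c ħ i * genK c ħ j = genK c ħ j * genK c ħ i := by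
  simpa [genK] using quot_rel c ħ (Rel.K_K i j)

theorem K_mul_E (i j : b.support) :
    genK c ħ i * genE c ħ j = qpow ħ (gram b c i j) • (genE c ħ j * genK c ħ i) := by
  simpa [genK, genE] using quot_rel c ħ (Rel.K_e i j)

theorem K_mul_F (i j : b.support) :
    genK c ħ i * genF c ħ j = qpow ħ (-gram b c i j) • (genF c ħ j * genK c ħ i) := by
  simpa [genK, genF] using quot_rel c ħ (Rel.K_f i j)

theorem E_F_same (i : b.support) :
    genE c ħ i * genF c ħ i - genF c ħ i * genE c ħ i =
      (Complex.exp ħ - (Complex.exp ħ)⁻¹)⁻¹ • (genK c ħ i - genKinv c ħ i) := by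
  simpa only [genK, genKinv, genE, genF, map_sub, map_mul, map_smul] using
    quot_rel c ħ (Rel.e_f_same i)

theorem E_F_ne (i j : b.support) (hij : i ≠ j) :
    genE c ħ i * genF c ħ j - genF c ħ j * genE c ħ i = 0 := by
  simpa only [genE, genF, map_sub, map_mul, map_zero] using quot_rel c ħ (Rel.e_f_ne i j hij)

theorem serre_E (i j : b.support) (hij : i ≠ j) :
    serre (qi b c ħ i) (serreExp b i j) (genE c ħ i) (genE c ħ j) = 0 := by
  simpa only [genE, map_serre, map_zero] using quot_rel c ħ (Rel.serre_e i j hij)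

theorem serre_F (i j : b.support) (hij : i ≠ j) :
    serre (qi b c ħ i) (serreExp b i j) (genF c ħ i) (genF c ħ j) = 0 := by
  simpa only [genF, map_serre, map_zero] using quot_rel c ħ (Rel.serre_f i j hij)

theorem qpow_mul_neg (x : ℂ) : qpow ħ x * qpow ħ (-x) = 1 := by
  unfold qpow
  rw [← Complex.exp_add]
  simp

theorem Kinv_mul_of {x : Uq b c ħ} {i : b.support} {y : ℂ}
    (h : genK c ħ i * x = qpow ħ y • (x * genK c ħ i)) :
    genKinv c ħ i * x = qpow ħ (-y) • (x * genKinv c ħ i) := by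
  have h1 : x = qpow ħ y • (genKinv c ħ i * x * genK c ħ i) := by
    calc x = genKinv c ħ i * (genK c ħ i * x) := by rw [← mul_assoc, Kinv_mul_K, one_mul]
      _ = _ := by rw [h, mul_smul_comm, mul_assoc]
  have h2 : x * genKinv c ħ i = qpow ħ y • (genKinv c ħ i * x) := by
    conv_lhs => rw [h1]
    rw [smul_mul_assoc, mul_assoc, K_mul_Kinv, mul_one]
  rw [h2, smul_smul, mul_comm, qpow_mul_neg, one_smul]

theorem Kinv_mul_E (i j : b.support) :
    genKinv c ħ i * genE c ħ j = qpow ħ (-gram b c i j) • (genE c ħ j * genKinv c ħ i) :=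
  Kinv_mul_of c ħ (K_mul_E c ħ i j)

theorem Kinv_mul_F (i j : b.support) :
    genKinv c ħ i * genF c ħ j = qpow ħ (gram b c i j) • (genF c ħ j * genKinv c ħ i) := by
  simpa using Kinv_mul_of c ħ (K_mul_F c ħ i j)

theorem Kinv_mul_K' (i j : b.support) :
    genKinv c ħ i * genK c ħ j = genK c ħ j * genKinv c ħ i := by
  have h : genK c ħ i * genK c ħ j = qpow ħ 0 • (genK c ħ j * genK c ħ i) := by
    simpa [qpow] using K_mul_K c ħ i j
  simpa [qpow] using Kinv_mul_of c ħ h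

theorem Kinv_mul_Kinv (i j : b.support) :
    genKinv c ħ i * genKinv c ħ j = genKinv c ħ j * genKinv c ħ i := by
  have h : genK c ħ i * genKinv c ħ j = qpow ħ 0 • (genKinv c ħ j * genK c ħ i) := by
    simpa [qpow] using (Kinv_mul_K' c ħ j i).symm
  simpa [qpow] using Kinv_mul_of c ħ h

/-- The values of `σ` on the generators. -/
def sigmaGen : Gen b.support → Uq b c ħ
  | .e i => genF c ħ i
  | .f i => genE c ħ i
  | .K i => genKinv c ħ i
  | .Kinv i => genK c ħ i

/-- The algebra automorphism `σ : e_α ↦ f_α, f_α ↦ e_α, q^{h_α} ↦ q^{-h_α}`. -/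
def sigma : Uq b c ħ →ₐ[ℂ] Uq b c ħ :=
  liftHom c ħ (FreeAlgebra.lift ℂ (sigmaGen c ħ)) (by
    intro x y h
    cases h with
    | K_Kinv i => simpa [sigmaGen] using Kinv_mul_K c ħ i
    | Kinv_K i => simpa [sigmaGen] using K_mul_Kinv c ħ i
    | K_K i j => simpa [sigmaGen] using Kinv_mul_Kinv c ħ i j
    | K_e i j => simpa [sigmaGen] using Kinv_mul_F c ħ i j
    | K_f i j => simpa [sigmaGen] using Kinv_mul_E c ħ i j
    | e_f_same i =>
      simp only [map_sub, map_mul, map_smul, FreeAlgebra.lift_ι_apply, sigmaGen]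
      rw [← neg_sub, E_F_same, ← smul_neg, neg_sub]
    | e_f_ne i j hij =>
      simp only [map_sub, map_mul, map_zero, FreeAlgebra.lift_ι_apply, sigmaGen]
      rw [← neg_sub, E_F_ne c ħ j i hij.symm, neg_zero]
    | serre_e i j hij =>
      simpa only [map_serre, map_zero, FreeAlgebra.lift_ι_apply, sigmaGen] using serre_F c ħ i j hij
    | serre_f i j hij =>
      simpa only [map_serre, map_zero, FreeAlgebra.lift_ι_apply, sigmaGen] using
        serre_E c ħ i j hij)

/-- The values of the inverse antipode on the generators. -/
def invAntipodeGen : Gen b.support → Uq b c ħ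
  | .e i => -(genKinv c ħ i * genE c ħ i)
  | .f i => -(genF c ħ i * genK c ħ i)
  | .K i => genKinv c ħ i
  | .Kinv i => genK c ħ i

set_option linter.unusedSimpArgs false in
/-- The inverse `γ⁻¹` of the antipode
`γ : f_α ↦ -q^{h_α} f_α, e_α ↦ -e_α q^{-h_α}, q^{± h_α} ↦ q^{∓ h_α}`,
as an algebra homomorphism to the opposite algebra. -/
def invAntipodeOp : Uq b c ħ →ₐ[ℂ] (Uq b c ħ)ᵐᵒᵖ :=
  liftHom c ħ (FreeAlgebra.lift ℂ fun x => MulOpposite.op (invAntipodeGen c ħ x)) (by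
    intro x y h
    apply MulOpposite.unop_injective
    cases h with
    | K_Kinv i => simpa [invAntipodeGen] using K_mul_Kinv c ħ i
    | Kinv_K i => simpa [invAntipodeGen] using Kinv_mul_K c ħ i
    | K_K i j => simpa [invAntipodeGen] using Kinv_mul_Kinv c ħ j i
    | K_e i j =>
      simp only [map_sub, map_mul, map_smul, map_zero, FreeAlgebra.lift_ι_apply, invAntipodeGen,
        MulOpposite.unop_mul, MulOpposite.unop_smul, MulOpposite.unop_sub, MulOpposite.unop_op,
        MulOpposite.unop_zero]
      rw [mul_neg, neg_mul, smul_neg, ← mul_assoc, Kinv_mul_Kinv c ħ i j, mul_assoc, mul_assoc,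
        Kinv_mul_E, mul_smul_comm, smul_smul, qpow_mul_neg, one_smul]
    | K_f i j =>
      simp only [map_sub, map_mul, map_smul, map_zero, FreeAlgebra.lift_ι_apply, invAntipodeGen,
        MulOpposite.unop_mul, MulOpposite.unop_smul, MulOpposite.unop_sub, MulOpposite.unop_op,
        MulOpposite.unop_zero]
      rw [mul_neg, neg_mul, smul_neg, ← mul_assoc, Kinv_mul_F, smul_mul_assoc, smul_smul,
        mul_comm (qpow ħ (-gram b c i j)), qpow_mul_neg, one_smul, mul_assoc, mul_assoc,
        Kinv_mul_K']
    | e_f_same i =>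
      simp only [map_sub, map_mul, map_smul, map_zero, FreeAlgebra.lift_ι_apply, invAntipodeGen,
        MulOpposite.unop_mul, MulOpposite.unop_smul, MulOpposite.unop_sub, MulOpposite.unop_op,
        MulOpposite.unop_zero]
      have h1 : genKinv c ħ i * genE c ħ i * (genF c ħ i * genK c ħ i) =
          genE c ħ i * genF c ħ i * (genK c ħ i * genKinv c ħ i) := by
        rw [Kinv_mul_E, smul_mul_assoc, mul_assoc, ← mul_assoc (genKinv c ħ i), Kinv_mul_F,
          smul_mul_assoc, mul_smul_comm, smul_smul, mul_comm (qpow ħ _), qpow_mul_neg, one_smul,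
          mul_assoc (genF c ħ i), Kinv_mul_K', mul_assoc]
      have h2 : genF c ħ i * genK c ħ i * (genKinv c ħ i * genE c ħ i) =
          genF c ħ i * genE c ħ i * (genK c ħ i * genKinv c ħ i) := by
        rw [Kinv_mul_E, mul_smul_comm, mul_assoc, ← mul_assoc (genK c ħ i), K_mul_E,
          smul_mul_assoc, mul_smul_comm, smul_smul, mul_comm (qpow ħ _), qpow_mul_neg, one_smul,
          mul_assoc (genE c ħ i), mul_assoc]
      rw [neg_mul_neg, neg_mul_neg, h1, h2, K_mul_Kinv, mul_one, mul_one, ← neg_sub, E_F_same,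
        ← smul_neg, neg_sub]
    | e_f_ne i j hij =>
      simp only [map_sub, map_mul, map_smul, map_zero, FreeAlgebra.lift_ι_apply, invAntipodeGen,
        MulOpposite.unop_mul, MulOpposite.unop_smul, MulOpposite.unop_sub, MulOpposite.unop_op,
        MulOpposite.unop_zero]
      have h1 : genKinv c ħ i * genE c ħ i * (genF c ħ j * genK c ħ j) =
          (qpow ħ (gram b c i j) * qpow ħ (-gram b c i i)) •
            (genE c ħ i * genF c ħ j * (genK c ħ j * genKinv c ħ i)) := by
        rw [Kinv_mul_E, smul_mul_assoc, mul_assoc, ← mul_assoc (genKinv c ħ i), Kinv_mul_F,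
          smul_mul_assoc, mul_smul_comm, smul_smul, mul_comm (qpow ħ _),
          mul_assoc (genF c ħ j), Kinv_mul_K', mul_assoc]
      have h2 : genF c ħ j * genK c ħ j * (genKinv c ħ i * genE c ħ i) =
          (qpow ħ (gram b c i j) * qpow ħ (-gram b c i i)) •
            (genF c ħ j * genE c ħ i * (genK c ħ j * genKinv c ħ i)) := by
        rw [Kinv_mul_E, mul_smul_comm, mul_assoc, ← mul_assoc (genK c ħ j), K_mul_E,
          smul_mul_assoc, mul_smul_comm, smul_smul, gram_comm b c j i, mul_comm (qpow ħ _),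
          mul_assoc (genE c ħ i), mul_assoc]
      rw [neg_mul_neg, neg_mul_neg, h1, h2, ← smul_sub, ← sub_mul, ← neg_sub, E_F_ne c ħ i j hij,
        neg_zero, zero_mul, smul_zero]
    | serre_e i j hij =>
      simp only [map_serre, map_zero, FreeAlgebra.lift_ι_apply, invAntipodeGen, unop_serre,
        MulOpposite.unop_op, MulOpposite.unop_zero]
      have e : ∀ k : b.support, -(genKinv c ħ k * genE c ħ k) =
          (-qpow ħ (-gram b c k k)) • (genE c ħ k * genKinv c ħ k) := by
        intro k
        rw [Kinv_mul_E, neg_smul]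
      rw [e, e, serre_twist _ _ _ _ (qpow ħ (-gram b c i i)) (qpow ħ (-gram b c i j)) _ _ _ _
        (Kinv_mul_E c ħ i i) (Kinv_mul_E c ħ i j) (by rw [Kinv_mul_E, gram_comm])
        (Kinv_mul_Kinv c ħ j i) (serre_E c ħ i j hij), smul_zero]
    | serre_f i j hij =>
      simp only [map_serre, map_zero, FreeAlgebra.lift_ι_apply, invAntipodeGen, unop_serre,
        MulOpposite.unop_op, MulOpposite.unop_zero]
      have e : ∀ k : b.support, -(genF c ħ k * genK c ħ k) =
          (-1 : ℂ) • (genF c ħ k * genK c ħ k) := by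
        intro k
        simp
      rw [e, e, serre_twist _ _ _ _ (qpow ħ (-gram b c i i)) (qpow ħ (-gram b c i j)) _ _ _ _
        (K_mul_F c ħ i i) (K_mul_F c ħ i j) (by rw [K_mul_F, gram_comm])
        (K_mul_K c ħ j i) (serre_F c ħ i j hij), smul_zero])

/-- The inverse antipode as a linear map of `U_q(𝔤)` to itself; it reverses products. -/
def invAntipode : Uq b c ħ →ₗ[ℂ] Uq b c ħ :=
  (MulOpposite.opLinearEquiv ℂ).symm.toLinearMap ∘ₗ (invAntipodeOp c ħ).toLinearMap

/-- The anti-automorphism `ω = γ⁻¹ ∘ σ`. -/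
def omega : Uq b c ħ →ₗ[ℂ] Uq b c ħ := invAntipode c ħ ∘ₗ (sigma c ħ).toLinearMap

theorem sigma_quot (x : Gen b.support) :
    sigma c ħ (quot b c ħ (FreeAlgebra.ι ℂ x)) = sigmaGen c ħ x := by
  rw [sigma, liftHom_quot, FreeAlgebra.lift_ι_apply]

theorem invAntipode_quot (x : Gen b.support) :
    invAntipode c ħ (quot b c ħ (FreeAlgebra.ι ℂ x)) = invAntipodeGen c ħ x := by
  change (invAntipodeOp c ħ (quot b c ħ (FreeAlgebra.ι ℂ x))).unop = _
  rw [invAntipodeOp, liftHom_quot, FreeAlgebra.lift_ι_apply, MulOpposite.unop_op]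

theorem invAntipode_mul (x y : Uq b c ħ) :
    invAntipode c ħ (x * y) = invAntipode c ħ y * invAntipode c ħ x := by
  change (invAntipodeOp c ħ (x * y)).unop = _
  rw [map_mul, MulOpposite.unop_mul]
  rfl

variable (b)

/-- The subalgebra `U_q(𝔤₋)` generated by the `f_α`. -/
def Uminus : Subalgebra ℂ (Uq b c ħ) := Algebra.adjoin ℂ (Set.range (genF c ħ))

/-- The scalar `q^{(α_i, mu)}`, by which `q^{h_α}` acts on vectors of weight `mu`. -/
def char (mu : Module.Dual ℂ H) (i : b.support) : ℂ := qpow ħ (form c (simpleRoot b i) mu)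

end QuantumGroup

/-! ### Modules -/

section Modules

variable {𝔤 : Type*} [LieRing 𝔤] [LieAlgebra ℂ 𝔤] [FiniteDimensional ℂ 𝔤]
  [LieAlgebra.IsKilling ℂ 𝔤] {H : LieSubalgebra ℂ 𝔤} [H.IsCartanSubalgebra]
  (b : (LieAlgebra.IsKilling.rootSystem H).Base) (c : ℚ) (ħ : ℂ)
  {V : Type*} [AddCommGroup V] [Module ℂ V] [Module (Uq b c ħ) V] [IsScalarTower ℂ (Uq b c ħ) V]
  {M : Type*} [AddCommGroup M] [Module ℂ M] [Module (Uq b c ħ) M] [IsScalarTower ℂ (Uq b c ħ) M]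

variable (V) in
/-- The weight subspace `V[mu]`. -/
def weightSpace (mu : Module.Dual ℂ H) : Submodule ℂ V :=
  ⨅ i : b.support, LinearMap.ker
    (Algebra.lsmul ℂ ℂ V (genK c ħ i) - char b c ħ mu i • LinearMap.id)

/-- `V` is a highest weight module of highest weight `mu` with highest vector `v`. -/
structure IsHighestWeight (mu : Module.Dual ℂ H) (v : V) : Prop where
  ne_zero : v ≠ 0
  weight : v ∈ weightSpace b c ħ V mu
  killed : ∀ i : b.support, genE c ħ i • v = 0
  cyclic : Submodule.span (Uq b c ħ) {v} = ⊤

/-- The action of `e_α` on `V ⊗ M` through `Δ(e_α) = e_α ⊗ q^{h_α} + 1 ⊗ e_α`. -/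
def tensorE (i : b.support) : V ⊗[ℂ] M →ₗ[ℂ] V ⊗[ℂ] M :=
  TensorProduct.map (Algebra.lsmul ℂ ℂ V (genE c ħ i)) (Algebra.lsmul ℂ ℂ M (genK c ħ i))
    + TensorProduct.map LinearMap.id (Algebra.lsmul ℂ ℂ M (genE c ħ i))

/-- The action of `q^{h_α}` on `V ⊗ M` through `Δ(q^{h_α}) = q^{h_α} ⊗ q^{h_α}`. -/
def tensorK (i : b.support) : V ⊗[ℂ] M →ₗ[ℂ] V ⊗[ℂ] M :=
  TensorProduct.map (Algebra.lsmul ℂ ℂ V (genK c ħ i)) (Algebra.lsmul ℂ ℂ M (genK c ħ i))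

/-- Singular vectors of `V ⊗ M`: non-zero weight vectors killed by all `e_α`. -/
def IsSingular (u : V ⊗[ℂ] M) : Prop :=
  u ≠ 0 ∧ (∃ mu : Module.Dual ℂ H, ∀ i, tensorK b c ħ i u = char b c ħ mu i • u) ∧
    ∀ i, tensorE b c ħ i u = 0

variable (V M) in
/-- The span `(V ⊗ M)⁺` of the singular vectors. -/
def singularSpan : Submodule ℂ (V ⊗[ℂ] M) := Submodule.span ℂ {u | IsSingular b c ħ u}

variable (M) in
/-- The sum of the weight subspaces of `M` of weights `≺ zeta`. -/
def lowerPart (zeta : Module.Dual ℂ H) : Submodule ℂ M :=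
  ⨆ beta : {x : Module.Dual ℂ H // x ∈ posCone b ∧ x ≠ 0}, weightSpace b c ħ M (zeta - beta)

/-- `v` is the leading coefficient of `u ∈ V ⊗ M`, where `M` is a highest weight module with highest
vector `m` of weight `zeta`: it is the coefficient of `m`, that is, `u` equals `v ⊗ m` up to terms
in `V ⊗ M[mu]` with `mu ≺ zeta`. -/
def IsLeadingCoeff (zeta : Module.Dual ℂ H) (m : M) (u : V ⊗[ℂ] M) (v : V) : Prop :=
  u - v ⊗ₜ[ℂ] m ∈ LinearMap.range (LinearMap.lTensor V (lowerPart b c ħ M zeta).subtype)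

/-- The ideal `I⁻ ⊆ U_q(𝔤₋)`, the annihilator of the highest vector `m`. -/
def annMinus (m : M) : Submodule ℂ (Uq b c ħ) where
  carrier := {x | x ∈ Uminus b c ħ ∧ x • m = 0}
  add_mem' := fun hx hy => ⟨add_mem hx.1 hy.1, by rw [add_smul, hx.2, hy.2, add_zero]⟩
  zero_mem' := ⟨zero_mem _, zero_smul _ _⟩
  smul_mem' := fun a x hx =>
    ⟨Subalgebra.smul_mem _ hx.1 a, by rw [smul_assoc, hx.2, smul_zero]⟩

/-- The ideal `I⁺ = σ(I⁻) ⊆ U_q(𝔤₊)`. -/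
def annPlus (m : M) : Submodule ℂ (Uq b c ħ) :=
  (annMinus b c ħ m).map (sigma c ħ).toLinearMap

variable (V) in
/-- The kernel in `V` of the ideal `I⁺`; this is `V⁺_Z` when `m` is the highest vector of `Z`. -/
def extremalSubspace (m : M) : Submodule ℂ V where
  carrier := {v | ∀ x ∈ annPlus b c ħ m, x • v = 0}
  add_mem' := fun hv hw x hx => by rw [smul_add, hv x hx, hw x hx, add_zero]
  zero_mem' := fun _ _ => smul_zero _
  smul_mem' := fun a v hv x hx => by rw [smul_comm, hv x hx, smul_zero]

variable (V) in
/-- The subspace `ω(I⁺) V`; this is `V^⊥_Z` when `m` is the highest vector of `Z`. -/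
def perpSubspace (m : M) : Submodule ℂ V :=
  Submodule.span ℂ {w | ∃ x ∈ annPlus b c ħ m, ∃ v : V, w = omega c ħ x • v}

/-- The map `V ⊗ U_q(𝔤₋) → V ⊗ M`, `∑ v_i ⊗ f_i ↦ ∑ v_i ⊗ f_i m`. -/
def present (m : M) : V ⊗[ℂ] Uminus b c ħ →ₗ[ℂ] V ⊗[ℂ] M :=
  LinearMap.lTensor V (((LinearMap.toSpanSingleton (Uq b c ħ) M m).restrictScalars ℂ) ∘ₗ
    (Uminus b c ħ).val.toLinearMap)

variable (V) in
/-- The map `V ⊗ U_q(𝔤₋) → V`, `∑ v_i ⊗ f_i ↦ ∑ γ⁻¹(f_i) v_i`. -/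
def contract : V ⊗[ℂ] Uminus b c ħ →ₗ[ℂ] V :=
  TensorProduct.lift (((Algebra.lsmul ℂ ℂ V).toLinearMap ∘ₗ invAntipode c ħ ∘ₗ
    (Uminus b c ħ).val.toLinearMap).flip)

/-- `θ : P → V / N` is the extremal twist for the highest weight module `M` with highest vector `m`
of weight `zeta`: the value `θ(v)` is the class of `∑ γ⁻¹(f_i) v_i` for any presentation
`u = ∑ v_i ⊗ f_i m` of a vector `u ∈ (V ⊗ M)⁺` with leading coefficient `v`. It is part of the
definition that such `u` and such a presentation exist for every `v ∈ P` and that the class does not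
depend on their choice. -/
def IsExtremalTwist (zeta : Module.Dual ℂ H) (m : M) (P N : Submodule ℂ V)
    (θ : P →ₗ[ℂ] V ⧸ N) : Prop :=
  ∀ (v : P) (w : V ⧸ N), θ v = w ↔
    ∃ t : V ⊗[ℂ] Uminus b c ħ, present b c ħ m t ∈ singularSpan b c ħ V M ∧
      IsLeadingCoeff b c ħ zeta m (present b c ħ m t) (v : V) ∧ w = N.mkQ (contract b c ħ V t)

/-! ### Verma modules -/

/-- The left ideal generated by `e_α` and `q^{h_α} - q^{(α, zeta)}`. -/
def vermaIdeal (zeta : Module.Dual ℂ H) : Submodule (Uq b c ħ) (Uq b c ħ) :=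
  Submodule.span (Uq b c ħ) (Set.range (genE c ħ) ∪
    Set.range fun i => genK c ħ i - algebraMap ℂ (Uq b c ħ) (char b c ħ zeta i))

/-- The Verma module of highest weight `zeta`. -/
abbrev Verma (zeta : Module.Dual ℂ H) : Type _ := Uq b c ħ ⧸ vermaIdeal b c ħ zeta

/-- The highest vector of the Verma module. -/
def vermaVec (zeta : Module.Dual ℂ H) : Verma b c ħ zeta := (vermaIdeal b c ħ zeta).mkQ 1

/-- The projection of the Verma module to a highest weight module of the same highest weight; it
sends highest vector to highest vector. -/
def vermaProj {zeta : Module.Dual ℂ H} {m : M} (hm : IsHighestWeight b c ħ zeta m) :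
    Verma b c ħ zeta →ₗ[Uq b c ħ] M :=
  (vermaIdeal b c ħ zeta).liftQ (LinearMap.toSpanSingleton (Uq b c ħ) M m) (by
    refine Submodule.span_le.mpr ?_
    rintro x (⟨i, rfl⟩ | ⟨i, rfl⟩)
    · simpa using hm.killed i
    · have h := (Submodule.mem_iInf _).mp hm.weight i
      simpa [sub_smul] using h)

theorem vermaProj_vermaVec {zeta : Module.Dual ℂ H} {m : M} (hm : IsHighestWeight b c ħ zeta m) :
    vermaProj b c ħ hm (vermaVec b c ħ zeta) = m := by
  exact one_smul _ _

variable (V) in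
/-- The span `V⁺_zeta` of the leading coefficients of the singular vectors of `V ⊗ Verma`. -/
def vermaExtremalSubspace (zeta : Module.Dual ℂ H) : Submodule ℂ V :=
  Submodule.span ℂ {v | ∃ u : V ⊗[ℂ] Verma b c ħ zeta, IsSingular b c ħ u ∧
    IsLeadingCoeff b c ħ zeta (vermaVec b c ħ zeta) u v}

end Modules

end

end QuantumTwist

open QuantumTwist

/-! The engine is the contravariant (Shapovalov) form `B` on `Z`, for which `B (x z) w = B z (ω(x)
w)`; it is non-degenerate because `Z` is simple. It turns a tensor `u` in `V ⊗ Z` into a map `ψ : Z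
→ V`, where `v ⊗ z` acts by `w ↦ B z w • v`. The coproduct and contravariance translate `e_α u = 0`
into `ψ (f_α w) = e_α ψ w`, and `ψ 1_ζ` is the leading coefficient of `u`. Hence `ψ (x 1_ζ) = σ(x)
v` for `x` in `U_q(𝔤₋)`: a combination of singular vectors is determined by its leading coefficient
`v`, and `v` is killed by `I⁺ = σ(I⁻)`.

Conversely, each `v` killed by `I⁺` defines such a `ψ` (`exists_intertwiner`). The `e_α` act locally
nilpotently on `V`, so `ψ` vanishes on all deep layers of `Z`; layers are finite-dimensional and
mutually orthogonal, so `ψ` comes from a tensor (`exists_pairing_eq`). Since `V⁺_Z` is torus-stable,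
weight vectors `v` suffice, and for these the tensor is a weight vector (`exists_mem_singularSpan`).

The class of `∑ γ⁻¹(f_i) v_i` depends only on `∑ v_i ⊗ f_i 1_ζ`: the ambiguity is `V ⊗ I⁻`, and
`γ⁻¹(I⁻) = ω(I⁺)` (`contract_mem_perpSubspace`). So `θ_{V,Z}` is well defined. A presentation of a
vector over the Verma module also presents its image over `Z`, with the same leading coefficient and
the same sum; thus `θ` for the Verma module is well defined and agrees with `θ_{V,Z}` once the
domains do. One inclusion of domains is projection to `Z`, the other is the lifting hypothesis.

Genericity of `q` serves to separate `ζ` from the lower weights, so that the coefficient of `1_ζ`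
makes sense in `Z`. This rests on `(β, β)` being a positive rational for non-zero `β` in the root
cone. -/

namespace QuantumTwist

/-! ### Rationality and positivity of the form, and separation of weights by `q`. -/

section RootLattice

variable {𝔤 : Type*} [LieRing 𝔤] [LieAlgebra ℂ 𝔤] [FiniteDimensional ℂ 𝔤]
  [LieAlgebra.IsKilling ℂ 𝔤] {H : LieSubalgebra ℂ 𝔤} [H.IsCartanSubalgebra]

open LieAlgebra.IsKilling

theorem traceForm_cartanEquivDual_symm (lam : Module.Dual ℂ H) (x : H) :
    LieModule.traceForm ℂ H 𝔤 ((cartanEquivDual H).symm lam) x = lam x := by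
  change cartanEquivDual H ((cartanEquivDual H).symm lam) x = lam x
  rw [LinearEquiv.apply_symm_apply]

theorem traceForm_eq_sum_root (x y : H) :
    LieModule.traceForm ℂ H 𝔤 x y =
      ∑ α : H.root, (α : LieModule.Weight ℂ H 𝔤) x * (α : LieModule.Weight ℂ H 𝔤) y := by
  have h := LinearMap.congr_fun₂ (restrict_killingForm_eq_sum (K := ℂ) (L := 𝔤) (H := H)) x y
  rw [LieAlgebra.restrict_killingForm] at h
  rw [h, ← Finset.sum_coe_sort]
  simp only [LinearMap.coe_sum, Finset.sum_apply, LinearMap.smulRight_apply, LinearMap.smul_apply,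
    smul_eq_mul]
  rfl

/-- The value `(β, α)` of the Killing form on roots is rational. -/
theorem exists_rat_apply_root (α β : H.root) :
    ∃ r : ℚ, (β : LieModule.Weight ℂ H 𝔤)
      ((cartanEquivDual H).symm (α : LieModule.Weight ℂ H 𝔤).toLinear) = r := by
  set t := (cartanEquivDual H).symm (α : LieModule.Weight ℂ H 𝔤).toLinear with ht
  have hα : (α : LieModule.Weight ℂ H 𝔤).IsNonZero := LieSubalgebra.isNonZero_coe_root α
  have h0 : (α : LieModule.Weight ℂ H 𝔤) t ≠ 0 := root_apply_cartanEquivDual_symm_ne_zero hα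
  -- The coroot of `α` is `2 / α(t)` times `t` and takes integral values on roots, so `γ(t)` is a
  -- half-integral multiple of `α(t)`.
  have hint : ∀ γ : H.root, ∃ n : ℚ, (γ : LieModule.Weight ℂ H 𝔤) t =
      n * (α : LieModule.Weight ℂ H 𝔤) t := by
    intro γ
    have h := apply_coroot_eq_cast (α : LieModule.Weight ℂ H 𝔤) (γ : LieModule.Weight ℂ H 𝔤)
    rw [coroot, ← LieModule.Weight.toLinear_apply (χ := (γ : LieModule.Weight ℂ H 𝔤)), map_nsmul,
      map_smul, ← ht, nsmul_eq_mul, smul_eq_mul, LieModule.Weight.toLinear_apply] at h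
    generalize ((LieModule.chainBotCoeff (α : LieModule.Weight ℂ H 𝔤)
      (γ : LieModule.Weight ℂ H 𝔤) : ℤ) - (LieModule.chainTopCoeff (α : LieModule.Weight ℂ H 𝔤)
      (γ : LieModule.Weight ℂ H 𝔤) : ℤ) : ℤ) = n at h
    refine ⟨n / 2, ?_⟩
    push_cast at h ⊢
    rw [← h]
    field_simp
  choose n hn using hint
  -- The Killing form is a sum over roots, so `α(t) = ∑ γ(t)²`. Cancelling one factor `α(t)`
  -- exhibits `α(t)` as the inverse of a rational number.
  have hsum : (α : LieModule.Weight ℂ H 𝔤) t * ((∑ γ : H.root, n γ ^ 2 : ℚ) : ℂ) = 1 := by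
    have h1 : (α : LieModule.Weight ℂ H 𝔤) t = LieModule.traceForm ℂ H 𝔤 t t := by
      rw [ht, traceForm_cartanEquivDual_symm]
      rfl
    rw [traceForm_eq_sum_root] at h1
    have h2 : ∑ γ : H.root, (γ : LieModule.Weight ℂ H 𝔤) t * (γ : LieModule.Weight ℂ H 𝔤) t =
        (α : LieModule.Weight ℂ H 𝔤) t *
          ((α : LieModule.Weight ℂ H 𝔤) t * ((∑ γ : H.root, n γ ^ 2 : ℚ) : ℂ)) := by
      push_cast
      rw [Finset.mul_sum, Finset.mul_sum]
      refine Finset.sum_congr rfl fun γ _ => ?_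
      rw [hn γ]
      ring
    rw [h2] at h1
    exact mul_left_cancel₀ h0 (by rw [← h1, mul_one])
  refine ⟨n β * (∑ γ : H.root, n γ ^ 2)⁻¹, ?_⟩
  rw [hn β]
  push_cast at hsum ⊢
  rw [eq_inv_of_mul_eq_one_left hsum]

variable (b : (LieAlgebra.IsKilling.rootSystem H).Base)

theorem exists_rat_root_apply_of_mem_posCone {x : Module.Dual ℂ H} (hx : x ∈ posCone b)
    (β : H.root) :
    ∃ r : ℚ, (β : LieModule.Weight ℂ H 𝔤) ((cartanEquivDual H).symm x) = r := by
  induction hx using AddSubmonoid.closure_induction with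
  | mem x hx =>
    obtain ⟨i, rfl⟩ := hx
    exact exists_rat_apply_root i.1 β
  | zero => exact ⟨0, by rw [map_zero, ← LieModule.Weight.toLinear_apply]; simp⟩
  | add x y _ _ hx hy =>
    obtain ⟨r, hr⟩ := hx
    obtain ⟨s, hs⟩ := hy
    exact ⟨r + s, by
      rw [← LieModule.Weight.toLinear_apply] at hr hs ⊢
      rw [map_add, map_add, hr, hs]; push_cast; rfl⟩

/-- The form is rational and positive on non-zero elements of the cone of simple roots. -/
theorem exists_rat_form_self (c : ℚ) (hc : 0 < c) {x : Module.Dual ℂ H} (hx : x ∈ posCone b)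
    (h0 : x ≠ 0) : ∃ r : ℚ, 0 < r ∧ form c x x = r := by
  choose r hr using exists_rat_root_apply_of_mem_posCone b hx
  -- Up to `c⁻¹` this is a sum of squares of the rational values of the roots on the vector dual to
  -- `x`. If all of them vanish, the vector is in the radical of the Killing form, and `x = 0`.
  have h1 : form c x x = ((c⁻¹ * ∑ α : H.root, r α ^ 2 : ℚ) : ℂ) := by
    rw [form, hvec, map_smul, ← traceForm_cartanEquivDual_symm, traceForm_eq_sum_root, smul_eq_mul]
    push_cast
    simp only [hr, sq]
  refine ⟨_, mul_pos (inv_pos.mpr hc) ?_, h1⟩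
  refine lt_of_le_of_ne (Finset.sum_nonneg fun _ _ => sq_nonneg _) fun hs => h0 ?_
  have hr0 : ∀ α, r α = 0 := fun α => by
    simpa using (Finset.sum_eq_zero_iff_of_nonneg (fun _ _ => sq_nonneg _)).mp hs.symm α
      (Finset.mem_univ α)
  ext y
  rw [← traceForm_cartanEquivDual_symm, traceForm_eq_sum_root]
  simp [hr, hr0]

theorem form_add_left (c : ℚ) (x y z : Module.Dual ℂ H) :
    form c (x + y) z = form c x z + form c y z := by
  simp [form, hvec]

theorem form_add_right (c : ℚ) (x y z : Module.Dual ℂ H) :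
    form c x (y + z) = form c x y + form c x z := by
  simp [form]

theorem form_sub_right (c : ℚ) (x y z : Module.Dual ℂ H) :
    form c x (y - z) = form c x y - form c x z := by
  simp [form]

theorem qpow_add (ħ x y : ℂ) : qpow ħ (x + y) = qpow ħ x * qpow ħ y := by
  rw [qpow, mul_add, Complex.exp_add]
  rfl

/-- If `q ^ (n / d) = 1`, then the `d`-th power gives `q ^ n = 1`. Rationality matters: `exp (ħ x)`
can be `1` for complex `x ≠ 0` even when `q` is not a root of unity. -/
theorem qpow_rat_ne_one {ħ : ℂ} (hq : ∀ n : ℕ, 0 < n → Complex.exp ħ ^ n ≠ 1) {r : ℚ}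
    (hr : 0 < r) : qpow ħ r ≠ 1 := by
  intro h
  have hn : 0 < r.num := Rat.num_pos.mpr hr
  refine hq r.num.toNat (by omega) ?_
  have h1 : (r : ℂ) * r.den = r.num.toNat := by
    have : (r.num.toNat : ℤ) = r.num := Int.toNat_of_nonneg hn.le
    have h2 : (r * r.den : ℚ) = r.num.toNat := by
      rw [Rat.mul_den_eq_num]
      exact_mod_cast this.symm
    exact_mod_cast congrArg (Rat.cast : ℚ → ℂ) h2
  calc Complex.exp ħ ^ r.num.toNat = Complex.exp (ħ * r) ^ r.den := by
        rw [← Complex.exp_nat_mul, ← Complex.exp_nat_mul, ← h1]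
        congr 1
        ring
    _ = 1 := by
        change qpow ħ r ^ _ = 1
        rw [h, one_pow]

theorem char_sub_simpleRoot (c : ℚ) (ħ : ℂ) (mu : Module.Dual ℂ H) (i j : b.support) :
    char b c ħ (mu - simpleRoot b j) i = qpow ħ (-gram b c i j) * char b c ħ mu i := by
  rw [char, form_sub_right, sub_eq_add_neg, add_comm, qpow_add]
  rfl

theorem char_add (c : ℚ) (ħ : ℂ) (mu nu : Module.Dual ℂ H) :
    char b c ħ (mu + nu) = char b c ħ mu * char b c ħ nu := by
  funext i
  rw [char, form_add_right, qpow_add]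
  rfl

theorem char_ne_zero (c : ℚ) (ħ : ℂ) (mu : Module.Dual ℂ H) (i : b.support) :
    char b c ħ mu i ≠ 0 := Complex.exp_ne_zero _

/-- For generic `q` the weights `zeta` and `zeta - beta` are separated by the torus. -/
theorem char_sub_ne_char (c : ℚ) (hc : 0 < c) {ħ : ℂ}
    (hq : ∀ n : ℕ, 0 < n → Complex.exp ħ ^ n ≠ 1) (zeta : Module.Dual ℂ H)
    {beta : Module.Dual ℂ H} (hb : beta ∈ posCone b) (h0 : beta ≠ 0) :
    char b c ħ (zeta - beta) ≠ char b c ħ zeta := by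
  intro h
  -- Equal characters give `q ^ (α_i, β) = 1` for all simple roots, hence `q ^ (x, β) = 1` on the
  -- whole cone; `x = β` contradicts positivity.
  have h1 : ∀ i, qpow ħ (form c (simpleRoot b i) beta) = 1 := by
    intro i
    have h2 := congrFun (char_add b c ħ (zeta - beta) beta) i
    rw [sub_add_cancel, Pi.mul_apply, h] at h2
    exact (mul_left_cancel₀ (char_ne_zero b c ħ zeta i) (by rw [mul_one]; exact h2)).symm
  have h2 : ∀ x ∈ posCone b, qpow ħ (form c x beta) = 1 := by
    intro x hx
    induction hx using AddSubmonoid.closure_induction with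
    | mem x hx =>
      obtain ⟨i, rfl⟩ := hx
      exact h1 i
    | zero => simp [form, hvec, qpow]
    | add x y _ _ hx hy => rw [form_add_left, qpow_add, hx, hy, one_mul]
  obtain ⟨r, hr, hrf⟩ := exists_rat_form_self b c hc hb h0
  exact qpow_rat_ne_one hq hr (hrf ▸ h2 beta hb)

theorem simpleRoot_mem_posCone (i : b.support) : simpleRoot b i ∈ posCone b :=
  AddSubmonoid.subset_closure ⟨i, rfl⟩

/-- Simple roots form a basis, so there is a height functional equal to `1` on each of them; it is a
natural number on the cone and positive on the sum. -/
theorem add_simpleRoot_ne_zero {x : Module.Dual ℂ H} (hx : x ∈ posCone b) (i : b.support) :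
    x + simpleRoot b i ≠ 0 := by
  obtain ⟨g, hg⟩ : ∃ g : Module.Dual ℂ H →ₗ[ℂ] ℂ, ∀ j, g (simpleRoot b j) = 1 :=
    ⟨b.toWeightBasis.constr ℂ fun _ => 1, fun j => by
      have := b.toWeightBasis.constr_basis ℂ (fun _ => (1 : ℂ)) j
      rwa [RootPairing.Base.toWeightBasis_apply] at this⟩
  have h : ∃ n : ℕ, g x = n := by
    induction hx using AddSubmonoid.closure_induction with
    | mem x hx =>
      obtain ⟨j, rfl⟩ := hx
      exact ⟨1, by simp [hg]⟩
    | zero => exact ⟨0, by simp⟩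
    | add x y _ _ hx hy =>
      obtain ⟨m, hm⟩ := hx
      obtain ⟨n, hn⟩ := hy
      exact ⟨m + n, by simp [hm, hn]⟩
  obtain ⟨n, hn⟩ := h
  intro h0
  have h1 := congrArg g h0
  rw [map_add, hn, hg, map_zero] at h1
  exact Nat.cast_add_one_ne_zero n h1

end RootLattice

end QuantumTwist

namespace QuantumTwist

/-! ### Highest weight modules: generation by the `f_α`, layers and weights. -/

section Generation

variable {𝔤 : Type*} [LieRing 𝔤] [LieAlgebra ℂ 𝔤] [FiniteDimensional ℂ 𝔤]
  [LieAlgebra.IsKilling ℂ 𝔤] {H : LieSubalgebra ℂ 𝔤} [H.IsCartanSubalgebra]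
  (b : (LieAlgebra.IsKilling.rootSystem H).Base) (c : ℚ) (ħ : ℂ)

theorem quot_surjective : Function.Surjective (quot b c ħ) :=
  RingQuot.mkAlgHom_surjective ℂ (Rel b c ħ)

variable {b} in
/-- Induction on an element of the quantum group. -/
theorem Uq_induction {p : Uq b c ħ → Prop} (x : Uq b c ħ)
    (algebraMap : ∀ a : ℂ, p (algebraMap ℂ (Uq b c ħ) a))
    (genE : ∀ i, p (genE c ħ i)) (genF : ∀ i, p (genF c ħ i)) (genK : ∀ i, p (genK c ħ i))
    (genKinv : ∀ i, p (genKinv c ħ i)) (mul : ∀ x y, p x → p y → p (x * y))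
    (add : ∀ x y, p x → p y → p (x + y)) : p x := by
  obtain ⟨x, rfl⟩ := quot_surjective b c ħ x
  induction x using FreeAlgebra.induction with
  | grade0 a => simpa using algebraMap a
  | grade1 g =>
    cases g with
    | e i => exact genE i
    | f i => exact genF i
    | K i => exact genK i
    | Kinv i => exact genKinv i
  | mul x y hx hy => rw [map_mul]; exact mul _ _ hx hy
  | add x y hx hy => rw [map_add]; exact add _ _ hx hy

variable {M : Type*} [AddCommGroup M] [Module ℂ M] [Module (Uq b c ħ) M]
  [IsScalarTower ℂ (Uq b c ħ) M]

variable {b c ħ}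

theorem smul_mem_of_generators {W : Submodule ℂ M}
    (hE : ∀ i : b.support, ∀ w ∈ W, genE c ħ i • w ∈ W) (hF : ∀ i : b.support, ∀ w ∈ W, genF c ħ i • w ∈ W)
    (hK : ∀ i : b.support, ∀ w ∈ W, genK c ħ i • w ∈ W) (hKinv : ∀ i : b.support, ∀ w ∈ W, genKinv c ħ i • w ∈ W)
    (x : Uq b c ħ) {w : M} (hw : w ∈ W) : x • w ∈ W := by
  induction x using Uq_induction c ħ generalizing w with
  | algebraMap a => rw [algebraMap_smul]; exact W.smul_mem a hw
  | genE i => exact hE i w hw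
  | genF i => exact hF i w hw
  | genK i => exact hK i w hw
  | genKinv i => exact hKinv i w hw
  | mul x y hx hy => rw [mul_smul]; exact hx (hy hw)
  | add x y hx hy => rw [add_smul]; exact W.add_mem (hx hw) (hy hw)

theorem mem_weightSpace {mu : Module.Dual ℂ H} {v : M} :
    v ∈ weightSpace b c ħ M mu ↔ ∀ i : b.support, genK c ħ i • v = char b c ħ mu i • v := by
  simp [weightSpace, Submodule.mem_iInf, sub_eq_zero]

theorem genKinv_smul_of_genK_smul {i : b.support} {a : ℂ} (ha : a ≠ 0) {v : M}
    (h : genK c ħ i • v = a • v) : genKinv c ħ i • v = a⁻¹ • v := by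
  have h1 : genKinv c ħ i • genK c ħ i • v = v := by rw [← mul_smul, Kinv_mul_K, one_smul]
  rw [h, smul_comm] at h1
  rw [eq_inv_smul_iff₀ ha, h1]

theorem mem_lowerPart_of_mem_weightSpace {zeta beta : Module.Dual ℂ H} (hb : beta ∈ posCone b)
    (h0 : beta ≠ 0) {v : M} (hv : v ∈ weightSpace b c ħ M (zeta - beta)) :
    v ∈ lowerPart b c ħ M zeta :=
  Submodule.mem_iSup_of_mem (p := fun beta : {x : Module.Dual ℂ H // x ∈ posCone b ∧ x ≠ 0} =>
    weightSpace b c ħ M (zeta - beta)) ⟨beta, hb, h0⟩ hv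

theorem lowerPart_le {zeta : Module.Dual ℂ H} {W : Submodule ℂ M}
    (h : ∀ beta ∈ posCone b, beta ≠ 0 → weightSpace b c ħ M (zeta - beta) ≤ W) :
    lowerPart b c ħ M zeta ≤ W :=
  iSup_le fun beta => h beta.1 beta.2.1 beta.2.2

theorem genF_smul_mem_weightSpace {mu : Module.Dual ℂ H} {v : M}
    (hv : v ∈ weightSpace b c ħ M mu) (j : b.support) :
    genF c ħ j • v ∈ weightSpace b c ħ M (mu - simpleRoot b j) := by
  rw [mem_weightSpace] at hv ⊢
  intro i
  rw [← mul_smul, K_mul_F, smul_assoc, mul_smul, hv, char_sub_simpleRoot, mul_smul,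
    smul_comm (genF c ħ j)]

theorem genE_genF_smul_mem {W : Submodule ℂ M} {i j : b.support} {v : M}
    (hF : genF c ħ j • genE c ħ i • v ∈ W) (hK : genK c ħ i • v ∈ W)
    (hKinv : genKinv c ħ i • v ∈ W) : genE c ħ i • genF c ħ j • v ∈ W := by
  by_cases hij : i = j
  · subst hij
    have h := congrArg (· • v) (E_F_same c ħ i)
    simp only [sub_smul, mul_smul, smul_assoc] at h
    rw [sub_eq_iff_eq_add.mp h]
    exact W.add_mem (W.smul_mem _ (W.sub_mem hK hKinv)) hF
  · have h := congrArg (· • v) (E_F_ne c ħ i j hij)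
    simp only [sub_smul, mul_smul, zero_smul] at h
    rwa [sub_eq_zero.mp h]

variable (b c ħ)

/-- The span of the vectors `f_{i₁} ⋯ f_{iₙ} m`. -/
def layer (m : M) : ℕ → Submodule ℂ M
  | 0 => Submodule.span ℂ {m}
  | n + 1 => ⨆ i : b.support, (layer m n).map (Algebra.lsmul ℂ ℂ M (genF c ħ i))

/-- `m` generates `M` and satisfies the defining relations of a highest vector of weight `zeta`;
it is not required to be non-zero. -/
structure IsHighestCyclic (zeta : Module.Dual ℂ H) (m : M) : Prop where
  weight : m ∈ weightSpace b c ħ M zeta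
  killed : ∀ i : b.support, genE c ħ i • m = 0
  cyclic : Submodule.span (Uq b c ħ) {m} = ⊤

variable {b c ħ}

theorem IsHighestWeight.isHighestCyclic {zeta : Module.Dual ℂ H} {m : M}
    (hm : IsHighestWeight b c ħ zeta m) : IsHighestCyclic b c ħ zeta m :=
  ⟨hm.weight, hm.killed, hm.cyclic⟩

variable (b c ħ) in
theorem isHighestCyclic_vermaVec (zeta : Module.Dual ℂ H) :
    IsHighestCyclic b c ħ zeta (vermaVec b c ħ zeta) where
  weight := by
    rw [mem_weightSpace]
    intro i
    rw [← sub_eq_zero, vermaVec, ← map_smul,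
      ← algebraMap_smul (Uq b c ħ) (char b c ħ zeta i) ((vermaIdeal b c ħ zeta).mkQ 1), ← map_smul,
      ← map_sub, smul_eq_mul, mul_one, smul_eq_mul, mul_one, ← LinearMap.mem_ker,
      Submodule.ker_mkQ]
    exact Submodule.subset_span (Or.inr ⟨i, rfl⟩)
  killed i := by
    rw [vermaVec, ← map_smul, smul_eq_mul, mul_one, ← LinearMap.mem_ker, Submodule.ker_mkQ]
    exact Submodule.subset_span (Or.inl ⟨i, rfl⟩)
  cyclic := by
    refine eq_top_iff.mpr fun x _ => ?_
    obtain ⟨x, rfl⟩ := Submodule.mkQ_surjective _ x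
    refine Submodule.mem_span_singleton.mpr ⟨x, ?_⟩
    rw [vermaVec, ← map_smul, smul_eq_mul, mul_one]

theorem genF_smul_mem_layer {m w : M} {n : ℕ} (hw : w ∈ layer b c ħ m n) (i : b.support) :
    genF c ħ i • w ∈ layer b c ħ m (n + 1) :=
  Submodule.mem_iSup_of_mem i ⟨w, hw, rfl⟩

/-- The family `W` varies with `n`, so that one induction covers both `f`-stable subspaces (constant
`W`) and statements that track the degree. -/
theorem layer_le_of_genF {m : M} {W : ℕ → Submodule ℂ M} (h0 : m ∈ W 0)
    (hF : ∀ n (i : b.support), ∀ w ∈ layer b c ħ m n, w ∈ W n → genF c ħ i • w ∈ W (n + 1)) (n : ℕ) :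
    layer b c ħ m n ≤ W n := by
  induction n with
  | zero => exact (Submodule.span_singleton_le_iff_mem _ _).mpr h0
  | succ n ih =>
    refine iSup_le fun i => ?_
    rintro _ ⟨w, hw, rfl⟩
    exact hF n i w hw (ih hw)

theorem finiteDimensional_layer (m : M) (n : ℕ) : FiniteDimensional ℂ (layer b c ħ m n) := by
  induction n with
  | zero => exact FiniteDimensional.span_singleton ℂ m
  | succ n ih => exact Submodule.finite_iSup _

section HighestCyclic

variable {zeta : Module.Dual ℂ H} {m : M} (hm : IsHighestCyclic b c ħ zeta m)

include hm

theorem IsHighestCyclic.genK_smul (i : b.support) : genK c ħ i • m = char b c ħ zeta i • m :=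
  mem_weightSpace.mp hm.weight i

theorem IsHighestCyclic.genK_smul_mem_layer (i : b.support) (n : ℕ) {w : M}
    (hw : w ∈ layer b c ħ m n) : genK c ħ i • w ∈ layer b c ħ m n := by
  refine layer_le_of_genF
    (W := fun n => (layer b c ħ m n).comap (Algebra.lsmul ℂ ℂ M (genK c ħ i))) ?_ ?_ n hw
  · change genK c ħ i • m ∈ layer b c ħ m 0
    rw [hm.genK_smul]
    exact Submodule.smul_mem _ _ (Submodule.mem_span_singleton_self m)
  · intro n j w _ hw
    change genK c ħ i • genF c ħ j • w ∈ layer b c ħ m (n + 1)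
    rw [← mul_smul, K_mul_F, smul_assoc, mul_smul]
    exact Submodule.smul_mem _ _ (genF_smul_mem_layer hw j)

theorem IsHighestCyclic.genKinv_smul_mem_layer (i : b.support) (n : ℕ) {w : M}
    (hw : w ∈ layer b c ħ m n) : genKinv c ħ i • w ∈ layer b c ħ m n := by
  refine layer_le_of_genF
    (W := fun n => (layer b c ħ m n).comap (Algebra.lsmul ℂ ℂ M (genKinv c ħ i))) ?_ ?_ n hw
  · change genKinv c ħ i • m ∈ layer b c ħ m 0
    rw [genKinv_smul_of_genK_smul (char_ne_zero b c ħ zeta i) (hm.genK_smul i)]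
    exact Submodule.smul_mem _ _ (Submodule.mem_span_singleton_self m)
  · intro n j w _ hw
    change genKinv c ħ i • genF c ħ j • w ∈ layer b c ħ m (n + 1)
    rw [← mul_smul, Kinv_mul_F, smul_assoc, mul_smul]
    exact Submodule.smul_mem _ _ (genF_smul_mem_layer hw j)

theorem IsHighestCyclic.genE_smul_layer_zero (i : b.support) {w : M}
    (hw : w ∈ layer b c ħ m 0) : genE c ħ i • w = 0 := by
  obtain ⟨a, rfl⟩ := Submodule.mem_span_singleton.mp hw
  rw [smul_comm, hm.killed, smul_zero]

theorem IsHighestCyclic.genE_smul_mem_layer (i : b.support) (n : ℕ) {w : M}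
    (hw : w ∈ layer b c ħ m (n + 1)) : genE c ħ i • w ∈ layer b c ħ m n := by
  -- Truncated subtraction puts layer `0` at `k = 0`, which is harmless since `e_i m = 0`.
  refine layer_le_of_genF
    (W := fun k => (layer b c ħ m (k - 1)).comap (Algebra.lsmul ℂ ℂ M (genE c ħ i))) ?_ ?_ _ hw
  · change genE c ħ i • m ∈ layer b c ħ m 0
    rw [hm.killed]
    exact zero_mem _
  · intro k j w hw hEw
    change genE c ħ i • genF c ħ j • w ∈ layer b c ħ m k
    refine genE_genF_smul_mem ?_ (hm.genK_smul_mem_layer i k hw) (hm.genKinv_smul_mem_layer i k hw)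
    cases k with
    | zero => rw [hm.genE_smul_layer_zero i hw, smul_zero]; exact zero_mem _
    | succ k => exact genF_smul_mem_layer hEw j

/-- The `e_α` lower the layer by one, the `f_α` raise it and the torus preserves it, so the sum of
the layers is a submodule containing the generator. This replaces the triangular decomposition. -/
theorem IsHighestCyclic.iSup_layer : ⨆ n, layer b c ħ m n = ⊤ := by
  have key : ∀ x : Uq b c ħ, ∀ n, ∀ w ∈ layer b c ħ m n, x • w ∈ ⨆ n, layer b c ħ m n := by
    have : ∀ x : Uq b c ħ, ∀ w ∈ ⨆ n, layer b c ħ m n, x • w ∈ ⨆ n, layer b c ħ m n := by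
      have step : ∀ x : Uq b c ħ, (∀ n, ∀ w ∈ layer b c ħ m n, x • w ∈ ⨆ n, layer b c ħ m n) →
          ∀ w ∈ ⨆ n, layer b c ħ m n, x • w ∈ ⨆ n, layer b c ħ m n := fun x hx w hw =>
        (iSup_le hx : _ ≤ (⨆ n, layer b c ħ m n).comap (Algebra.lsmul ℂ ℂ M x)) hw
      intro x w hw
      refine smul_mem_of_generators (fun i => step _ ?_) (fun i => step _ ?_) (fun i => step _ ?_)
        (fun i => step _ ?_) x hw
      · intro n w hw
        cases n with
        | zero => rw [hm.genE_smul_layer_zero i hw]; exact zero_mem _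
        | succ n => exact Submodule.mem_iSup_of_mem n (hm.genE_smul_mem_layer i n hw)
      · exact fun n w hw => Submodule.mem_iSup_of_mem (n + 1) (genF_smul_mem_layer hw i)
      · exact fun n w hw => Submodule.mem_iSup_of_mem n (hm.genK_smul_mem_layer i n hw)
      · exact fun n w hw => Submodule.mem_iSup_of_mem n (hm.genKinv_smul_mem_layer i n hw)
    exact fun x n w hw => this x w (Submodule.mem_iSup_of_mem n hw)
  refine eq_top_iff.mpr fun w _ => ?_
  obtain ⟨x, rfl⟩ := Submodule.mem_span_singleton.mp
    (hm.cyclic ▸ Submodule.mem_top : w ∈ Submodule.span (Uq b c ħ) {m})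
  exact key x 0 m (Submodule.mem_span_singleton_self m)

/-- A subspace that contains the highest vector and is stable under the `f_α` is everything. -/
theorem IsHighestCyclic.mem_of_genF {W : Submodule ℂ M} (h0 : m ∈ W)
    (hF : ∀ i : b.support, ∀ w ∈ W, genF c ħ i • w ∈ W) (w : M) : w ∈ W := by
  have h1 : ⨆ n, layer b c ħ m n ≤ W :=
    iSup_le fun n => layer_le_of_genF (W := fun _ => W) h0 (fun _ i w _ hw => hF i w hw) n
  rw [hm.iSup_layer] at h1
  exact h1 Submodule.mem_top

theorem IsHighestCyclic.exists_Uminus_smul (w : M) : ∃ x ∈ Uminus b c ħ, x • m = w := by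
  let T : Uq b c ħ →ₗ[ℂ] M := (LinearMap.toSpanSingleton (Uq b c ħ) M m).restrictScalars ℂ
  refine hm.mem_of_genF (W := (Subalgebra.toSubmodule (Uminus b c ħ)).map T)
    ⟨1, one_mem (Uminus b c ħ), one_smul _ m⟩ ?_ w
  rintro i _ ⟨x, hx, rfl⟩
  refine ⟨genF c ħ i * x, mul_mem (S := Subalgebra ℂ (Uq b c ħ)) (s := Uminus b c ħ)
    (Algebra.subset_adjoin ⟨i, rfl⟩) hx, ?_⟩
  exact mul_smul _ x m

/-- Each `f_α` strictly lowers the weight, hence maps the span of `m` plus the lower part into the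
lower part; that sum is therefore `f`-stable and contains `m`. The second claim later shows that the
coefficient of `m` vanishes on `f_α M`. -/
theorem IsHighestCyclic.mem_span_sup_lowerPart (w : M) :
    w ∈ Submodule.span ℂ {m} ⊔ lowerPart b c ħ M zeta ∧
      ∀ i : b.support, genF c ħ i • w ∈ lowerPart b c ħ M zeta := by
  have hlow : ∀ i : b.support, ∀ w ∈ lowerPart b c ħ M zeta, genF c ħ i • w ∈ lowerPart b c ħ M zeta := by
    intro i w hw
    refine lowerPart_le (W := (lowerPart b c ħ M zeta).comap (Algebra.lsmul ℂ ℂ M (genF c ħ i)))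
      (fun beta hb _ w hw => ?_) hw
    have h := genF_smul_mem_weightSpace hw i
    rw [sub_sub] at h
    exact mem_lowerPart_of_mem_weightSpace (add_mem hb (simpleRoot_mem_posCone b i))
      (add_simpleRoot_ne_zero b hb i) h
  have htop : ∀ i : b.support, genF c ħ i • m ∈ lowerPart b c ħ M zeta := by
    intro i
    have h := genF_smul_mem_weightSpace hm.weight i
    refine mem_lowerPart_of_mem_weightSpace (simpleRoot_mem_posCone b i) ?_ h
    simpa using add_simpleRoot_ne_zero b (zero_mem _) i
  have hsup : ∀ w ∈ Submodule.span ℂ {m} ⊔ lowerPart b c ħ M zeta, ∀ i : b.support,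
      genF c ħ i • w ∈ lowerPart b c ħ M zeta := by
    intro w hw i
    obtain ⟨x, hx, y, hy, rfl⟩ := Submodule.mem_sup.mp hw
    obtain ⟨a, rfl⟩ := Submodule.mem_span_singleton.mp hx
    rw [smul_add, smul_comm]
    exact add_mem (Submodule.smul_mem _ _ (htop i)) (hlow i y hy)
  have hw : w ∈ Submodule.span ℂ {m} ⊔ lowerPart b c ħ M zeta :=
    hm.mem_of_genF (Submodule.mem_sup_left (Submodule.mem_span_singleton_self m))
      (fun i w hw => Submodule.mem_sup_right (hsup w hw i)) w
  exact ⟨hw, hsup w hw⟩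

theorem IsHighestCyclic.iSup_weightSpace : ⨆ mu, weightSpace b c ħ M mu = ⊤ := by
  refine eq_top_iff.mpr fun w _ => hm.mem_of_genF (Submodule.mem_iSup_of_mem zeta hm.weight) ?_ w
  intro i w hw
  refine (iSup_le ?_ : _ ≤ (⨆ mu, weightSpace b c ħ M mu).comap
    (Algebra.lsmul ℂ ℂ M (genF c ħ i))) hw
  exact fun mu w hw => Submodule.mem_iSup_of_mem _ (genF_smul_mem_weightSpace hw i)

end HighestCyclic

/-! ### Interpolation on torus characters. -/

section Interpolation

/-- Characters of the torus are separated by polynomials in the `q^{h_α}`. -/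
theorem exists_interpolation (F : Finset (b.support → ℂ)) {chi : b.support → ℂ} (hchi : chi ∉ F) :
    ∃ p ∈ Algebra.adjoin ℂ (Set.range (genK (b := b) c ħ)),
      (∀ v : M, (∀ i : b.support, genK c ħ i • v = chi i • v) → p • v = v) ∧
      ∀ chi' ∈ F, ∀ v : M, (∀ i : b.support, genK c ħ i • v = chi' i • v) → p • v = 0 := by
  classical
  induction F using Finset.induction_on with
  | empty => exact ⟨1, one_mem (Algebra.adjoin ℂ _), fun v _ => one_smul _ v, by simp⟩
  | insert x F _ ih =>
    rw [Finset.mem_insert, not_or] at hchi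
    obtain ⟨p, hp, h1, h2⟩ := ih hchi.2
    obtain ⟨i, hi⟩ := Function.ne_iff.mp hchi.1
    -- The new Lagrange factor acts by `1` on vectors of character `chi` and by `0` on those of
    -- character `x`.
    have ev : ∀ (y : b.support → ℂ) (v : M), (∀ i : b.support, genK c ħ i • v = y i • v) →
        ((chi i - x i)⁻¹ • (genK c ħ i - algebraMap ℂ (Uq b c ħ) (x i))) • v =
          ((chi i - x i)⁻¹ * (y i - x i)) • v := by
      intro y v hv
      rw [smul_assoc, sub_smul, hv, algebraMap_smul, ← sub_smul, smul_smul]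
    refine ⟨p * ((chi i - x i)⁻¹ • (genK c ħ i - algebraMap ℂ (Uq b c ħ) (x i))),
      mul_mem hp (Subalgebra.smul_mem _ (sub_mem (Algebra.subset_adjoin (Set.mem_range_self i))
        (Subalgebra.algebraMap_mem _ _)) _), ?_, ?_⟩
    · intro v hv
      rw [mul_smul, ev chi v hv, inv_mul_cancel₀ (sub_ne_zero.mpr hi), one_smul, h1 v hv]
    · intro y hy v hv
      rw [mul_smul, ev y v hv]
      rcases Finset.mem_insert.mp hy with rfl | hy
      · rw [sub_self, mul_zero, zero_smul, smul_zero]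
      · rw [smul_comm, h2 y hy v hv, smul_zero]

theorem smul_mem_of_mem_adjoin_genK {W : Submodule ℂ M} (hW : ∀ i : b.support, ∀ w ∈ W, genK c ħ i • w ∈ W)
    {p : Uq b c ħ} (hp : p ∈ Algebra.adjoin ℂ (Set.range (genK (b := b) c ħ))) {w : M}
    (hw : w ∈ W) : p • w ∈ W := by
  induction hp using Algebra.adjoin_induction generalizing w with
  | mem x hx =>
    obtain ⟨i, rfl⟩ := hx
    exact hW i w hw
  | algebraMap a => rw [algebraMap_smul]; exact W.smul_mem a hw
  | add x y _ _ hx hy => rw [add_smul]; exact W.add_mem (hx hw) (hy hw)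
  | mul x y _ _ hx hy => rw [mul_smul]; exact hx (hy hw)

/-- In a sum of weight spaces, a torus-stable subspace is spanned by weight vectors. -/
theorem le_span_weight_vectors (htop : ⨆ mu, weightSpace b c ħ M mu = ⊤) {W : Submodule ℂ M}
    (hW : ∀ i : b.support, ∀ w ∈ W, genK c ħ i • w ∈ W) :
    W ≤ Submodule.span ℂ {w | w ∈ W ∧ ∃ mu, w ∈ weightSpace b c ħ M mu} := by
  classical
  -- Different weights can have the same character, and then the same weight space. Indexing by
  -- characters makes the summands separable by interpolation.
  let S : Set.range (char b c ħ) → Submodule ℂ M := fun chi =>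
    weightSpace b c ħ M chi.2.choose
  have hS : ∀ (chi : Set.range (char b c ħ)) (w : M),
      w ∈ S chi ↔ ∀ i : b.support, genK c ħ i • w = chi.1 i • w := fun chi w => by
    change w ∈ weightSpace b c ħ M chi.2.choose ↔ _
    rw [mem_weightSpace, chi.2.choose_spec]
  have hStop : ⨆ chi, S chi = ⊤ := by
    refine eq_top_iff.mpr (htop ▸ iSup_le fun mu w hw => ?_)
    exact Submodule.mem_iSup_of_mem (⟨_, mu, rfl⟩ : Set.range (char b c ħ))
      ((hS _ w).mpr (mem_weightSpace.mp hw))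
  intro w hw
  obtain ⟨f, hf, hfw⟩ := (Submodule.mem_iSup_iff_exists_finsupp S w).mp
    (hStop ▸ Submodule.mem_top)
  rw [← hfw]
  refine Submodule.sum_mem _ fun chi hchi => Submodule.subset_span ⟨?_, _, hf chi⟩
  obtain ⟨p, hp, h1, h2⟩ := exists_interpolation (M := M) (c := c) (ħ := ħ)
    ((f.support.erase chi).image Subtype.val) (chi := chi.1) (by
      rw [Finset.mem_image]
      rintro ⟨x, hx, he⟩
      exact (Finset.mem_erase.mp hx).1 (Subtype.ext he))
  have h3 : p • w = f chi := by
    rw [← hfw, Finsupp.sum, Finset.smul_sum, Finset.sum_eq_single_of_mem chi hchi]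
    · exact h1 _ ((hS _ _).mp (hf chi))
    · intro x hx hne
      exact h2 x.1 (Finset.mem_image_of_mem _ (Finset.mem_erase.mpr ⟨hne, hx⟩)) _
        ((hS _ _).mp (hf x))
  rw [← h3]
  exact smul_mem_of_mem_adjoin_genK hW hp hw

/-- A torus element that fixes the character of `zeta` and kills the finitely many lower characters
in a decomposition of `m` would give `m = 0`. Genericity of `q` enters here. -/
theorem IsHighestWeight.notMem_lowerPart (hc : 0 < c)
    (hq : ∀ n : ℕ, 0 < n → Complex.exp ħ ^ n ≠ 1) {zeta : Module.Dual ℂ H} {m : M}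
    (hm : IsHighestWeight b c ħ zeta m) : m ∉ lowerPart b c ħ M zeta := by
  classical
  intro h
  obtain ⟨f, hf, hfm⟩ := (Submodule.mem_iSup_iff_exists_finsupp _ m).mp h
  obtain ⟨p, -, h1, h2⟩ := exists_interpolation (M := M) (c := c) (ħ := ħ)
    (f.support.image fun beta : {x : Module.Dual ℂ H // x ∈ posCone b ∧ x ≠ 0} =>
      char b c ħ (zeta - beta)) (chi := char b c ħ zeta) (by
      simp only [Finset.mem_image, not_exists, not_and]
      exact fun x _ => char_sub_ne_char b c hc hq zeta x.2.1 x.2.2)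
  refine hm.ne_zero ?_
  rw [← h1 m (mem_weightSpace.mp hm.weight), ← hfm, Finsupp.sum, Finset.smul_sum]
  exact Finset.sum_eq_zero fun x hx =>
    h2 _ (Finset.mem_image_of_mem _ hx) _ (mem_weightSpace.mp (hf x))

end Interpolation

end Generation

end QuantumTwist

namespace QuantumTwist

/-! ### The contravariant form of a highest weight module. -/

section ContravariantForm

variable {𝔤 : Type*} [LieRing 𝔤] [LieAlgebra ℂ 𝔤] [FiniteDimensional ℂ 𝔤]
  [LieAlgebra.IsKilling ℂ 𝔤] {H : LieSubalgebra ℂ 𝔤} [H.IsCartanSubalgebra]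
  {b : (LieAlgebra.IsKilling.rootSystem H).Base} {c : ℚ} {ħ : ℂ}

theorem omega_mul (x y : Uq b c ħ) : omega c ħ (x * y) = omega c ħ y * omega c ħ x := by
  change invAntipode c ħ (sigma c ħ (x * y)) = _
  rw [map_mul, invAntipode_mul]
  rfl

theorem omega_genE (i : b.support) : omega c ħ (genE c ħ i) = -(genF c ħ i * genK c ħ i) := by
  change invAntipode c ħ (sigma c ħ (genE c ħ i)) = _
  rw [genE, sigma_quot]
  exact invAntipode_quot c ħ (Gen.f i)

theorem omega_genF (i : b.support) :
    omega c ħ (genF c ħ i) = -(genKinv c ħ i * genE c ħ i) := by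
  change invAntipode c ħ (sigma c ħ (genF c ħ i)) = _
  rw [genF, sigma_quot]
  exact invAntipode_quot c ħ (Gen.e i)

theorem omega_genK (i : b.support) : omega c ħ (genK c ħ i) = genK c ħ i := by
  change invAntipode c ħ (sigma c ħ (genK c ħ i)) = _
  rw [genK, sigma_quot]
  exact invAntipode_quot c ħ (Gen.Kinv i)

theorem omega_genKinv (i : b.support) : omega c ħ (genKinv c ħ i) = genKinv c ħ i := by
  change invAntipode c ħ (sigma c ħ (genKinv c ħ i)) = _
  rw [genKinv, sigma_quot]
  exact invAntipode_quot c ħ (Gen.K i)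

theorem omega_algebraMap (a : ℂ) :
    omega c ħ (algebraMap ℂ (Uq b c ħ) a) = algebraMap ℂ (Uq b c ħ) a := by
  change (invAntipodeOp c ħ (sigma c ħ (algebraMap ℂ (Uq b c ħ) a))).unop = _
  rw [AlgHom.commutes, AlgHom.commutes]
  rfl

theorem omega_one : omega c ħ (1 : Uq b c ħ) = 1 := by
  simpa using omega_algebraMap (b := b) (c := c) (ħ := ħ) 1

/-- Two reversals of products cancel, so generators suffice. Involutivity is what makes the
contravariant form well defined and symmetric. -/
theorem omega_omega (x : Uq b c ħ) : omega c ħ (omega c ħ x) = x := by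
  induction x using Uq_induction c ħ with
  | algebraMap a => rw [omega_algebraMap, omega_algebraMap]
  | genE i =>
    rw [omega_genE, map_neg, omega_mul, omega_genK, omega_genF, mul_neg, neg_neg, ← mul_assoc,
      K_mul_Kinv, one_mul]
  | genF i =>
    rw [omega_genF, map_neg, omega_mul, omega_genKinv, omega_genE, neg_mul, neg_neg, mul_assoc,
      K_mul_Kinv, mul_one]
  | genK i => rw [omega_genK, omega_genK]
  | genKinv i => rw [omega_genKinv, omega_genKinv]
  | mul x y hx hy => rw [omega_mul, omega_mul, hx, hy]
  | add x y hx hy => rw [map_add, map_add, hx, hy]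

theorem sigma_genF (i : b.support) : sigma c ħ (genF c ħ i) = genE c ħ i :=
  sigma_quot c ħ (Gen.f i)

theorem sigma_sigma (x : Uq b c ħ) : sigma c ħ (sigma c ħ x) = x := by
  induction x using Uq_induction c ħ with
  | algebraMap a => rw [AlgHom.commutes, AlgHom.commutes]
  | genE i => exact (congrArg _ (sigma_quot c ħ (Gen.e i))).trans (sigma_quot c ħ (Gen.f i))
  | genF i => exact (congrArg _ (sigma_quot c ħ (Gen.f i))).trans (sigma_quot c ħ (Gen.e i))
  | genK i => exact (congrArg _ (sigma_quot c ħ (Gen.K i))).trans (sigma_quot c ħ (Gen.Kinv i))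
  | genKinv i => exact (congrArg _ (sigma_quot c ħ (Gen.Kinv i))).trans (sigma_quot c ħ (Gen.K i))
  | mul x y hx hy => rw [map_mul, map_mul, hx, hy]
  | add x y hx hy => rw [map_add, map_add, hx, hy]

/-- A linear map factors through a surjection whose kernel it kills. -/
theorem exists_factor_of_ker_le {A B C : Type*} [AddCommGroup A] [Module ℂ A] [AddCommGroup B]
    [Module ℂ B] [AddCommGroup C] [Module ℂ C] (T : A →ₗ[ℂ] B) (hT : Function.Surjective T)
    (S : A →ₗ[ℂ] C) (h : ∀ a, T a = 0 → S a = 0) : ∃ g : B →ₗ[ℂ] C, ∀ a, g (T a) = S a := by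
  obtain ⟨s, hs⟩ := T.exists_rightInverse_of_surjective (LinearMap.range_eq_top.mpr hT)
  refine ⟨S ∘ₗ s, fun a => ?_⟩
  rw [← sub_eq_zero, LinearMap.comp_apply, ← map_sub]
  refine h _ ?_
  rw [map_sub, sub_eq_zero]
  exact LinearMap.congr_fun hs (T a)

variable (b c ħ) in
/-- The map `x ↦ x m`. -/
def orbitMap {M : Type*} [AddCommGroup M] [Module ℂ M] [Module (Uq b c ħ) M]
    [IsScalarTower ℂ (Uq b c ħ) M] (m : M) : Uq b c ħ →ₗ[ℂ] M :=
  (LinearMap.toSpanSingleton (Uq b c ħ) M m).restrictScalars ℂ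

section

variable {M : Type*} [AddCommGroup M] [Module ℂ M] [Module (Uq b c ħ) M]
  [IsScalarTower ℂ (Uq b c ħ) M]

theorem orbitMap_apply (m : M) (x : Uq b c ħ) : orbitMap b c ħ m x = x • m := rfl

variable (b c ħ) in
/-- A functional that reads off the coefficient of the highest vector. -/
structure IsHighestCoeff (zeta : Module.Dual ℂ H) (m : M) (ε : M →ₗ[ℂ] ℂ) : Prop where
  apply_self : ε m = 1
  apply_lowerPart : ∀ w ∈ lowerPart b c ħ M zeta, ε w = 0

theorem IsHighestWeight.exists_isHighestCoeff (hc : 0 < c)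
    (hq : ∀ n : ℕ, 0 < n → Complex.exp ħ ^ n ≠ 1) {zeta : Module.Dual ℂ H} {m : M}
    (hm : IsHighestWeight b c ħ zeta m) : ∃ ε, IsHighestCoeff b c ħ zeta m ε := by
  obtain ⟨g, hg, hker⟩ := Submodule.exists_le_ker_of_notMem (hm.notMem_lowerPart hc hq)
  refine ⟨(g m)⁻¹ • g, inv_mul_cancel₀ hg, fun w hw => ?_⟩
  rw [LinearMap.smul_apply, hker hw, smul_zero]

variable {zeta : Module.Dual ℂ H} {m : M} (hm : IsHighestCyclic b c ħ zeta m)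
  {ε : M →ₗ[ℂ] ℂ} (hε : IsHighestCoeff b c ħ zeta m ε)

include hm hε

theorem IsHighestCoeff.apply_genF_smul (i : b.support) (w : M) : ε (genF c ħ i • w) = 0 :=
  hε.apply_lowerPart _ ((hm.mem_span_sup_lowerPart w).2 i)

theorem IsHighestCoeff.apply_genK_smul (i : b.support) (w : M) :
    ε (genK c ħ i • w) = char b c ħ zeta i * ε w := by
  let W : Submodule ℂ M := LinearMap.ker
    (ε ∘ₗ Algebra.lsmul ℂ ℂ M (genK c ħ i) - char b c ħ zeta i • ε)
  have hW : ∀ w, w ∈ W ↔ ε (genK c ħ i • w) = char b c ħ zeta i * ε w := fun w => by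
    simp [W, sub_eq_zero]
  refine (hW w).mp (hm.mem_of_genF (W := W) ?_ ?_ w)
  · rw [hW, hm.genK_smul, map_smul, smul_eq_mul]
  · intro j w _
    rw [hW, ← mul_smul, K_mul_F, smul_assoc, mul_smul, map_smul, hε.apply_genF_smul hm,
      hε.apply_genF_smul hm, smul_zero, mul_zero]

/-- The Shapovalov functional `x ↦ ε (x m)` is invariant under `ω`. -/
theorem IsHighestCoeff.apply_omega_smul (x : Uq b c ħ) :
    ε (omega c ħ x • m) = ε (x • m) := by
  -- The defect `D` of invariance kills the left ideal that defines the Verma module, so it can be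
  -- tested there, on `1` and on the products `f_i y`. On the latter both terms vanish: `ω(f_i) m`
  -- is a multiple of `e_i m` by a torus element, and `ε` vanishes on `f_i M`.
  let D : Uq b c ħ →ₗ[ℂ] ℂ := ε ∘ₗ orbitMap b c ħ m ∘ₗ omega c ħ - ε ∘ₗ orbitMap b c ħ m
  have hD : ∀ x, D x = ε (omega c ħ x • m) - ε (x • m) := fun _ => rfl
  have hE : ∀ x i, D (x * genE c ħ i) = 0 := by
    intro x i
    rw [hD, omega_mul, omega_genE, mul_smul, neg_smul, mul_smul, map_neg, hε.apply_genF_smul hm,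
      mul_smul, hm.killed, smul_zero, map_zero, neg_zero, sub_zero]
  have hK : ∀ x i, D (x * (genK c ħ i - algebraMap ℂ (Uq b c ħ) (char b c ħ zeta i))) = 0 := by
    intro x i
    rw [hD, omega_mul, map_sub, omega_genK, omega_algebraMap, mul_smul, mul_smul, sub_smul,
      sub_smul, map_sub, hε.apply_genK_smul hm, algebraMap_smul, hm.genK_smul, algebraMap_smul,
      sub_self, smul_zero, map_zero, map_smul ε (char b c ħ zeta i), smul_eq_mul, sub_self,
      sub_zero]
  have hker : ∀ y ∈ vermaIdeal b c ħ zeta, ∀ x, D (x * y) = 0 := by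
    intro y hy
    induction hy using Submodule.span_induction with
    | mem y hy =>
      rcases hy with ⟨i, rfl⟩ | ⟨i, rfl⟩
      · exact fun x => hE x i
      · exact fun x => hK x i
    | zero => simp
    | add y z _ _ hy hz => intro x; rw [mul_add, map_add, hy, hz, add_zero]
    | smul a y _ hy => intro x; rw [smul_eq_mul, ← mul_assoc, hy]
  let W : Submodule ℂ (Verma b c ħ zeta) :=
    (LinearMap.ker D).map ((vermaIdeal b c ħ zeta).mkQ.restrictScalars ℂ)
  have hmem : ∀ w, w ∈ W := by
    refine (isHighestCyclic_vermaVec b c ħ zeta).mem_of_genF ⟨1, ?_, rfl⟩ ?_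
    · change D 1 = 0
      rw [hD, omega_one, sub_self]
    · rintro i _ ⟨y, -, rfl⟩
      refine ⟨genF c ħ i * y, ?_, map_smul (vermaIdeal b c ħ zeta).mkQ (genF c ħ i) y⟩
      change D (genF c ħ i * y) = 0
      rw [hD, omega_mul, omega_genF, mul_smul, neg_smul, mul_smul, hm.killed, smul_zero, neg_zero,
        smul_zero, map_zero, mul_smul, hε.apply_genF_smul hm, sub_zero]
  obtain ⟨y, hy, hyx⟩ := hmem ((vermaIdeal b c ħ zeta).mkQ x)
  have h1 : y - x ∈ vermaIdeal b c ħ zeta := (Submodule.Quotient.eq _).mp hyx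
  have h2 := hker _ h1 1
  rw [one_mul, map_sub, LinearMap.mem_ker.mp hy, zero_sub, neg_eq_zero, hD, sub_eq_zero] at h2
  exact h2

/-- The contravariant form of a highest weight module. -/
theorem IsHighestCoeff.exists_form :
    ∃ B : M →ₗ[ℂ] Module.Dual ℂ M, ∀ (x : Uq b c ħ) (w : M), B (x • m) w = ε (omega c ħ x • w) := by
  have hsurj : Function.Surjective (orbitMap b c ħ m) := fun w => by
    obtain ⟨x, -, hx⟩ := hm.exists_Uminus_smul w
    exact ⟨x, hx⟩
  obtain ⟨B, hB⟩ := exists_factor_of_ker_le (orbitMap b c ħ m) hsurj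
    (LinearMap.compRight ℂ ε ∘ₗ (Algebra.lsmul ℂ ℂ M).toLinearMap ∘ₗ omega c ħ) (by
      intro x hx
      ext w
      -- With `w = y m`, invariance under `ω` turns `ε (ω(x) y m)` into `ε (ω(y) x m)`, which
      -- vanishes when `x m = 0`.
      obtain ⟨y, rfl⟩ := hsurj w
      change ε (omega c ħ x • y • m) = 0
      rw [← mul_smul, ← hε.apply_omega_smul hm, omega_mul, omega_omega, mul_smul,
        ← orbitMap_apply m x, hx, smul_zero, map_zero])
  exact ⟨B, fun x w => LinearMap.congr_fun (hB x) w⟩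

end

section

variable {M : Type*} [AddCommGroup M] [Module ℂ M] [Module (Uq b c ħ) M]
  [IsScalarTower ℂ (Uq b c ħ) M]
  {zeta : Module.Dual ℂ H} {m : M} (hm : IsHighestCyclic b c ħ zeta m)
  {ε : M →ₗ[ℂ] ℂ} (hε : IsHighestCoeff b c ħ zeta m ε)
  {B : M →ₗ[ℂ] Module.Dual ℂ M} (hB : ∀ (x : Uq b c ħ) (w : M), B (x • m) w = ε (omega c ħ x • w))

include hm hB

theorem form_smul (x : Uq b c ħ) (z w : M) : B (x • z) w = B z (omega c ħ x • w) := by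
  obtain ⟨y, -, rfl⟩ := hm.exists_Uminus_smul z
  rw [← mul_smul, hB, hB, omega_mul, mul_smul]

include hε

theorem form_symm (z w : M) : B z w = B w z := by
  obtain ⟨x, -, rfl⟩ := hm.exists_Uminus_smul z
  obtain ⟨y, -, rfl⟩ := hm.exists_Uminus_smul w
  rw [hB, hB, ← mul_smul, ← hε.apply_omega_smul hm, omega_mul, omega_omega, mul_smul]

theorem form_apply_highest (z : M) : B z m = ε z := by
  rw [form_symm hm hε hB]
  have h := hB 1 z
  rwa [one_smul, omega_one, one_smul] at h

/-- By simplicity a non-zero `z` satisfies `x z = m` for some `x`, and then `B z (ω(x) m) = ε (x z)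
= 1`. -/
theorem form_injective [IsSimpleModule (Uq b c ħ) M] (z : M) (hz : B z = 0) : z = 0 := by
  by_contra h0
  obtain ⟨x, hx⟩ := IsSimpleModule.toSpanSingleton_surjective (Uq b c ħ) h0 m
  have h1 : ε (x • z) = 0 := by
    rw [← omega_omega x, ← hB, form_symm hm hε hB, hz, LinearMap.zero_apply]
  rw [LinearMap.toSpanSingleton_apply] at hx
  rw [hx, hε.apply_self] at h1
  exact one_ne_zero h1

/-- Distinct layers are orthogonal. -/
theorem form_layer_eq_zero {k n : ℕ} (hkn : k ≠ n) {z w : M} (hz : z ∈ layer b c ħ m k)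
    (hw : w ∈ layer b c ħ m n) : B z w = 0 := by
  -- Moving an outer `f_i` of `z` across the form applies `e_i` to `w`; the shallower vector is
  -- exhausted first.
  have key : ∀ k n : ℕ, n < k → ∀ z ∈ layer b c ħ m k, ∀ w ∈ layer b c ħ m n, B z w = 0 := by
    intro k
    induction k with
    | zero => exact fun n hn => absurd hn (Nat.not_lt_zero n)
    | succ k ih =>
      intro n hn z hz w hw
      have hle : layer b c ħ m (k + 1) ≤ LinearMap.ker (B.flip w) := by
        refine iSup_le fun i => ?_
        rintro _ ⟨z, hz, rfl⟩
        change B (genF c ħ i • z) w = 0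
        rw [form_smul hm hB, omega_genF, neg_smul, mul_smul, map_neg, neg_eq_zero]
        cases n with
        | zero => rw [hm.genE_smul_layer_zero i hw, smul_zero, map_zero]
        | succ n =>
          exact ih n (Nat.lt_of_succ_lt_succ hn) z hz _
            (hm.genKinv_smul_mem_layer i n (hm.genE_smul_mem_layer i n hw))
      exact hle hz
  rcases lt_or_gt_of_ne hkn with h | h
  · rw [form_symm hm hε hB]
    exact key n k h w hw z hz
  · exact key k n h z hz w hw

end

end ContravariantForm

end QuantumTwist

namespace QuantumTwist

/-! ### Tensors in `V ⊗ M` as maps `M → V`. -/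

section Pairing

variable {V M : Type*} [AddCommGroup V] [Module ℂ V] [AddCommGroup M] [Module ℂ M]

/-- The map `V ⊗ M → Hom(M, V)` induced by a bilinear form on `M`. -/
noncomputable def pairing (B : M →ₗ[ℂ] Module.Dual ℂ M) : V ⊗[ℂ] M →ₗ[ℂ] M →ₗ[ℂ] V :=
  dualTensorHom ℂ M V ∘ₗ (TensorProduct.comm ℂ V (Module.Dual ℂ M)).toLinearMap ∘ₗ
    LinearMap.lTensor V B

theorem pairing_tmul (B : M →ₗ[ℂ] Module.Dual ℂ M) (v : V) (z w : M) :
    pairing B (v ⊗ₜ z) w = B z w • v := by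
  simp [pairing, dualTensorHom_apply]

/-- In a basis of `V`, the coordinates of `u` are vectors of `M` orthogonal to everything. -/
theorem pairing_injective {B : M →ₗ[ℂ] Module.Dual ℂ M} (hB : ∀ z, B z = 0 → z = 0)
    {u : V ⊗[ℂ] M} (hu : pairing B u = 0) : u = 0 := by
  let e := Module.Basis.ofVectorSpace ℂ V
  obtain ⟨f, rfl⟩ := TensorProduct.eq_repr_basis_left e u
  have hf : ∀ i, f i = 0 := by
    intro i
    refine hB _ (LinearMap.ext fun w => ?_)
    have h1 := LinearMap.congr_fun hu w
    rw [Finsupp.sum, map_sum, LinearMap.sum_apply] at h1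
    simp only [pairing_tmul, LinearMap.zero_apply] at h1
    by_cases hi : i ∈ f.support
    · exact linearIndependent_iff'.mp e.linearIndependent f.support (fun i => B (f i) w) h1 i hi
    · rw [Finsupp.notMem_support_iff.mp hi, map_zero]
  exact Finset.sum_eq_zero fun i _ => by
    simp only [hf i, TensorProduct.tmul_zero]

/-- A non-degenerate form identifies the finite-dimensional `Z` with its dual, so maps `Z → V` are
tensors in `V ⊗ Z`. Such a tensor involves vectors of `Z` only, hence vanishes on the orthogonal
complement of `Z`. -/
theorem exists_pairing_eq_on {B : M →ₗ[ℂ] Module.Dual ℂ M} (Z : Submodule ℂ M)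
    [FiniteDimensional ℂ Z] (hZ : ∀ z ∈ Z, (∀ w ∈ Z, B z w = 0) → z = 0) (ψ : M →ₗ[ℂ] V) :
    ∃ u : V ⊗[ℂ] M, (∀ w ∈ Z, pairing B u w = ψ w) ∧
      ∀ w, (∀ z ∈ Z, B z w = 0) → pairing B u w = 0 := by
  let B' : Z →ₗ[ℂ] Module.Dual ℂ Z := LinearMap.lcomp ℂ ℂ Z.subtype ∘ₗ B ∘ₗ Z.subtype
  have hB' : ∀ z w : Z, B' z w = B z w := fun _ _ => rfl
  have hinj : Function.Injective B' := by
    refine (injective_iff_map_eq_zero B').mpr fun z hz => Subtype.ext (hZ z.1 z.2 fun w hw => ?_)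
    rw [← hB' z ⟨w, hw⟩, hz, LinearMap.zero_apply]
  have hsurj : Function.Surjective B' :=
    (LinearMap.injective_iff_surjective_of_finrank_eq_finrank
      Subspace.dual_finrank_eq.symm).mp hinj
  obtain ⟨d, hd⟩ := (dualTensorHomEquiv ℂ Z V).surjective (ψ ∘ₗ Z.subtype)
  obtain ⟨t, ht⟩ := LinearMap.lTensor_surjective V hsurj ((TensorProduct.comm ℂ _ _).symm d)
  refine ⟨LinearMap.lTensor V Z.subtype t, fun w hw => ?_, fun w hw => ?_⟩
  · have h1 : ∀ t : V ⊗[ℂ] Z, pairing B (LinearMap.lTensor V Z.subtype t) w =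
        dualTensorHom ℂ Z V (TensorProduct.comm ℂ _ _ (LinearMap.lTensor V B' t)) ⟨w, hw⟩ := by
      intro t
      induction t using TensorProduct.induction_on with
      | zero => simp
      | tmul v z => simp [pairing_tmul, dualTensorHom_apply, hB']
      | add x y hx hy => simp only [map_add, LinearMap.add_apply, hx, hy]
    rw [h1, ht, LinearEquiv.apply_symm_apply]
    exact LinearMap.congr_fun hd ⟨w, hw⟩
  · clear ht
    induction t using TensorProduct.induction_on with
    | zero => simp
    | tmul v z => rw [LinearMap.lTensor_tmul, pairing_tmul, Submodule.subtype_apply, hw z.1 z.2,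
        zero_smul]
    | add x y hx hy => rw [map_add, map_add, LinearMap.add_apply, hx, hy, add_zero]

end Pairing

/-! ### Singular vectors as maps that exchange `f_α` with `e_α`. -/

section Singular

variable {𝔤 : Type*} [LieRing 𝔤] [LieAlgebra ℂ 𝔤] [FiniteDimensional ℂ 𝔤]
  [LieAlgebra.IsKilling ℂ 𝔤] {H : LieSubalgebra ℂ 𝔤} [H.IsCartanSubalgebra]
  {b : (LieAlgebra.IsKilling.rootSystem H).Base} {c : ℚ} {ħ : ℂ}
  {V : Type*} [AddCommGroup V] [Module ℂ V] [Module (Uq b c ħ) V] [IsScalarTower ℂ (Uq b c ħ) V]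
  {M : Type*} [AddCommGroup M] [Module ℂ M] [Module (Uq b c ħ) M] [IsScalarTower ℂ (Uq b c ħ) M]

variable (b c ħ V) in
/-- The vectors killed by all products of `n` generators `e_α`. -/
def nilpotentPart : ℕ → Submodule ℂ V
  | 0 => ⊥
  | n + 1 => ⨅ i : b.support, (nilpotentPart n).comap (Algebra.lsmul ℂ ℂ V (genE c ħ i))

theorem mem_nilpotentPart_succ {n : ℕ} {v : V} :
    v ∈ nilpotentPart b c ħ V (n + 1) ↔
      ∀ i : b.support, genE c ħ i • v ∈ nilpotentPart b c ħ V n := by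
  simp [nilpotentPart, Submodule.mem_iInf]

theorem nilpotentPart_mono : Monotone (nilpotentPart b c ħ V) := by
  refine monotone_nat_of_le_succ fun n => ?_
  induction n with
  | zero => exact bot_le
  | succ n ih =>
    intro v hv
    rw [mem_nilpotentPart_succ] at hv ⊢
    exact fun i => ih (hv i)

theorem IsHighestCyclic.exists_mem_nilpotentPart {nu : Module.Dual ℂ H} {v₀ : V}
    (hV : IsHighestCyclic b c ħ nu v₀) (v : V) : ∃ n, v ∈ nilpotentPart b c ħ V n := by
  have h1 : ∀ k, layer b c ħ v₀ k ≤ nilpotentPart b c ħ V (k + 1) := by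
    intro k
    induction k with
    | zero =>
      intro w hw
      rw [mem_nilpotentPart_succ]
      intro i
      rw [hV.genE_smul_layer_zero i hw]
      exact zero_mem _
    | succ k ih =>
      intro w hw
      rw [mem_nilpotentPart_succ]
      exact fun i => ih (hV.genE_smul_mem_layer i k hw)
  have h2 : v ∈ ⨆ n, nilpotentPart b c ħ V n :=
    (hV.iSup_layer ▸ iSup_le fun k => (h1 k).trans (le_iSup _ (k + 1)) :
      (⊤ : Submodule ℂ V) ≤ _) Submodule.mem_top
  exact (Submodule.mem_iSup_of_directed _ nilpotentPart_mono.directed_le).mp h2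

/-- On layer `n`, `ψ` applies `n` generators `e_α` to `ψ m`. The induction uses `nilpotentPart` at
`N - n`, which truncated subtraction makes zero once `n ≥ N`. -/
theorem intertwiner_layer_eq_zero {m : M} {ψ : M →ₗ[ℂ] V}
    (hψ : ∀ (i : b.support) (z : M), ψ (genF c ħ i • z) = genE c ħ i • ψ z) {N : ℕ}
    (hN : ψ m ∈ nilpotentPart b c ħ V N) {n : ℕ} (hn : N ≤ n) {z : M}
    (hz : z ∈ layer b c ħ m n) : ψ z = 0 := by
  have h := layer_le_of_genF (m := m) (c := c) (ħ := ħ)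
    (W := fun n => (nilpotentPart b c ħ V (N - n)).comap ψ) hN (fun n i w _ hw => by
      change ψ (genF c ħ i • w) ∈ nilpotentPart b c ħ V (N - (n + 1))
      rw [hψ]
      change ψ w ∈ nilpotentPart b c ħ V (N - n) at hw
      rcases Nat.lt_or_ge n N with h | h
      · obtain ⟨k, hk⟩ : ∃ k, N - n = k + 1 := ⟨N - n - 1, by omega⟩
        rw [hk, mem_nilpotentPart_succ] at hw
        rw [show N - (n + 1) = k by omega]
        exact hw i
      · rw [Nat.sub_eq_zero_of_le h] at hw
        rw [(Submodule.mem_bot ℂ).mp hw, smul_zero]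
        exact zero_mem _) n hz
  change ψ z ∈ nilpotentPart b c ħ V (N - n) at h
  rw [Nat.sub_eq_zero_of_le hn] at h
  exact (Submodule.mem_bot ℂ).mp h

section

variable {zeta : Module.Dual ℂ H} {m : M} (hm : IsHighestCyclic b c ħ zeta m)
  {B : M →ₗ[ℂ] Module.Dual ℂ M} {ε : M →ₗ[ℂ] ℂ} (hε : IsHighestCoeff b c ħ zeta m ε)
  (hB : ∀ (x : Uq b c ħ) (w : M), B (x • m) w = ε (omega c ħ x • w))

theorem intertwiner_apply_smul {ψ : M →ₗ[ℂ] V}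
    (hψ : ∀ (i : b.support) (z : M), ψ (genF c ħ i • z) = genE c ħ i • ψ z)
    {x : Uq b c ħ} (hx : x ∈ Uminus b c ħ) (z : M) : ψ (x • z) = sigma c ħ x • ψ z := by
  induction hx using Algebra.adjoin_induction generalizing z with
  | mem x hx =>
    obtain ⟨i, rfl⟩ := hx
    rw [hψ, sigma_genF]
  | algebraMap a => rw [algebraMap_smul, AlgHom.commutes, algebraMap_smul, map_smul]
  | add x y _ _ hx hy => rw [add_smul, map_add, map_add, add_smul, hx, hy]
  | mul x y _ _ hx hy => rw [mul_smul, map_mul, mul_smul, hx, hy]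

-- The only candidate is `x m ↦ σ(x) v` for `x` in `U_q(𝔤₋)`; it is well defined precisely because
-- `σ(I⁻)` kills `v`.
include hm in
theorem exists_intertwiner {v : V} (hv : v ∈ extremalSubspace b c ħ V m) :
    ∃ ψ : M →ₗ[ℂ] V, ψ m = v ∧
      ∀ (i : b.support) (z : M), ψ (genF c ħ i • z) = genE c ħ i • ψ z := by
  obtain ⟨ψ, hψ⟩ := exists_factor_of_ker_le
    (orbitMap b c ħ m ∘ₗ (Uminus b c ħ).val.toLinearMap)
    (fun w => by
      obtain ⟨x, hx, hxw⟩ := hm.exists_Uminus_smul w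
      exact ⟨⟨x, hx⟩, hxw⟩)
    (orbitMap b c ħ v ∘ₗ (sigma c ħ).toLinearMap ∘ₗ (Uminus b c ħ).val.toLinearMap)
    (fun x hx => hv _ ⟨x.1, ⟨x.2, hx⟩, rfl⟩)
  have hψ' : ∀ x ∈ Uminus b c ħ, ψ (x • m) = sigma c ħ x • v := fun x hx => hψ ⟨x, hx⟩
  refine ⟨ψ, ?_, fun i z => ?_⟩
  · have h := hψ' 1 (one_mem _)
    rwa [one_smul, map_one, one_smul] at h
  · obtain ⟨x, hx, rfl⟩ := hm.exists_Uminus_smul z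
    rw [← mul_smul, hψ' _ hx, hψ' _ (mul_mem (S := Subalgebra ℂ (Uq b c ħ)) (s := Uminus b c ħ)
      (Algebra.subset_adjoin (Set.mem_range_self i)) hx), map_mul, mul_smul, sigma_genF]

include hm hB

/-- Contravariance moves `q^{h_α}` across the form unchanged and `e_α` as `-f_α q^{h_α}`. As
`q^{h_α}` is invertible, `e_α u = 0` becomes the exchange relation for `pairing B u`. -/
theorem pairing_tensorE (i : b.support) (u : V ⊗[ℂ] M) (w : M) :
    pairing B (tensorE b c ħ i u) w =
      genE c ħ i • pairing B u (genK c ħ i • w) -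
        pairing B u (genF c ħ i • genK c ħ i • w) := by
  induction u using TensorProduct.induction_on with
  | zero => simp
  | tmul v z =>
    simp only [tensorE, LinearMap.add_apply, TensorProduct.map_tmul, Algebra.lsmul_coe,
      LinearMap.id_apply, map_add, pairing_tmul]
    rw [form_smul hm hB, form_smul hm hB, omega_genK, omega_genE, neg_smul, mul_smul, map_neg,
      neg_smul, smul_comm, sub_eq_add_neg]
  | add x y hx hy =>
    rw [map_add, map_add, map_add, LinearMap.add_apply, LinearMap.add_apply, LinearMap.add_apply,
      hx, hy, smul_add]
    abel

theorem pairing_tensorK (i : b.support) (u : V ⊗[ℂ] M) (w : M) :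
    pairing B (tensorK b c ħ i u) w = genK c ħ i • pairing B u (genK c ħ i • w) := by
  induction u using TensorProduct.induction_on with
  | zero => simp
  | tmul v z =>
    simp only [tensorK, TensorProduct.map_tmul, Algebra.lsmul_coe, pairing_tmul]
    rw [form_smul hm hB, omega_genK, smul_comm]
  | add x y hx hy =>
    rw [map_add, map_add, map_add, LinearMap.add_apply, LinearMap.add_apply, hx, hy, smul_add]

theorem pairing_genF_smul {u : V ⊗[ℂ] M} (hu : ∀ i, tensorE b c ħ i u = 0) (i : b.support)
    (z : M) : pairing B u (genF c ħ i • z) = genE c ħ i • pairing B u z := by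
  have h := pairing_tensorE hm hB i u (genKinv c ħ i • z)
  rw [hu, map_zero, LinearMap.zero_apply, ← mul_smul (genK c ħ i), K_mul_Kinv, one_smul] at h
  exact (sub_eq_zero.mp h.symm).symm

include hε

-- Pairing with `m` is `ε`, which reads off the coefficient of `m`. In particular the leading
-- coefficient is unique.
omit [Module (Uq b c ħ) V] [IsScalarTower ℂ (Uq b c ħ) V] in
theorem pairing_apply_of_isLeadingCoeff {u : V ⊗[ℂ] M} {v : V}
    (h : IsLeadingCoeff b c ħ zeta m u v) : pairing B u m = v := by
  obtain ⟨t, ht⟩ := h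
  have h1 : pairing B (LinearMap.lTensor V (lowerPart b c ħ M zeta).subtype t) m = 0 := by
    clear ht
    induction t using TensorProduct.induction_on with
    | zero => simp
    | tmul v z =>
      rw [LinearMap.lTensor_tmul, pairing_tmul, form_apply_highest hm hε hB,
        Submodule.subtype_apply, hε.apply_lowerPart _ z.2, zero_smul]
    | add x y hx hy => rw [map_add, map_add, LinearMap.add_apply, hx, hy, add_zero]
  rw [ht, map_sub, LinearMap.sub_apply, pairing_tmul, form_apply_highest hm hε hB, hε.apply_self,
    one_smul, sub_eq_zero] at h1
  exact h1

/-- A combination of singular vectors is determined by its leading coefficient. -/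
theorem eq_zero_of_isLeadingCoeff_zero [IsSimpleModule (Uq b c ħ) M] {u : V ⊗[ℂ] M}
    (hu : ∀ i, tensorE b c ħ i u = 0) (h : IsLeadingCoeff b c ħ zeta m u 0) : u = 0 := by
  refine pairing_injective (form_injective hm hε hB) (LinearMap.ext fun z => ?_)
  obtain ⟨x, hx, rfl⟩ := hm.exists_Uminus_smul z
  rw [intertwiner_apply_smul (pairing_genF_smul hm hB hu) hx,
    pairing_apply_of_isLeadingCoeff hm hε hB h, smul_zero, LinearMap.zero_apply]

theorem mem_extremalSubspace_of_isLeadingCoeff {u : V ⊗[ℂ] M} {v : V}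
    (hu : ∀ i, tensorE b c ħ i u = 0) (h : IsLeadingCoeff b c ħ zeta m u v) :
    v ∈ extremalSubspace b c ħ V m := by
  rintro _ ⟨x, hx, rfl⟩
  change sigma c ħ x • v = 0
  rw [← pairing_apply_of_isLeadingCoeff hm hε hB h,
    ← intertwiner_apply_smul (pairing_genF_smul hm hB hu) hx.1, hx.2, map_zero]

-- Let `Z` be the sum of the layers below `N`. The deeper layers are orthogonal to `Z`, so the form
-- stays non-degenerate on `Z`, and a tensor over `Z` that matches `ψ` there vanishes on the deeper
-- layers, as `ψ` does.
omit [Module (Uq b c ħ) V] [IsScalarTower ℂ (Uq b c ħ) V] in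
theorem exists_pairing_eq [IsSimpleModule (Uq b c ħ) M] {ψ : M →ₗ[ℂ] V} {N : ℕ}
    (hψ : ∀ n, N ≤ n → ∀ z ∈ layer b c ħ m n, ψ z = 0) : ∃ u, pairing B u = ψ := by
  let Z : Submodule ℂ M := ⨆ n : Fin N, layer b c ħ m n
  have hfin : ∀ n : Fin N, FiniteDimensional ℂ (layer b c ħ m n) :=
    fun n => finiteDimensional_layer m n
  have : FiniteDimensional ℂ Z := Submodule.finite_iSup _
  have horth : ∀ n, N ≤ n → ∀ w ∈ layer b c ħ m n, ∀ z ∈ Z, B z w = 0 := by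
    intro n hn w hw z hz
    exact (iSup_le fun k z hz => form_layer_eq_zero hm hε hB (by have := k.2; omega) hz hw :
      Z ≤ LinearMap.ker (B.flip w)) hz
  have hle : ∀ W : Submodule ℂ M, Z ≤ W → (∀ n, N ≤ n → layer b c ħ m n ≤ W) → ∀ w, w ∈ W := by
    intro W h1 h2 w
    have h3 : ⨆ n, layer b c ħ m n ≤ W := iSup_le fun n => by
      rcases Nat.lt_or_ge n N with h | h
      · exact (le_iSup (fun n : Fin N => layer b c ħ m n) ⟨n, h⟩).trans h1
      · exact h2 n h
    rw [hm.iSup_layer] at h3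
    exact h3 Submodule.mem_top
  obtain ⟨u, hu1, hu2⟩ := exists_pairing_eq_on (B := B) Z (fun z hz hzZ => by
    refine form_injective hm hε hB z (LinearMap.ext fun w => ?_)
    exact hle (LinearMap.ker (B z)) hzZ (fun n hn w hw => horth n hn w hw z hz) w) ψ
  refine ⟨u, LinearMap.ext fun w => sub_eq_zero.mp ?_⟩
  refine hle (LinearMap.ker (pairing B u - ψ)) (fun w hw => ?_) (fun n hn w hw => ?_) w
  · rw [LinearMap.mem_ker, LinearMap.sub_apply, hu1 w hw, sub_self]
  · rw [LinearMap.mem_ker, LinearMap.sub_apply, hu2 w (horth n hn w hw), hψ n hn w hw, sub_self]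

end

end Singular

end QuantumTwist

namespace QuantumTwist

section Twist

variable {𝔤 : Type*} [LieRing 𝔤] [LieAlgebra ℂ 𝔤] [FiniteDimensional ℂ 𝔤]
  [LieAlgebra.IsKilling ℂ 𝔤] {H : LieSubalgebra ℂ 𝔤} [H.IsCartanSubalgebra]
  {b : (LieAlgebra.IsKilling.rootSystem H).Base} {c : ℚ} {ħ : ℂ}
  {V : Type*} [AddCommGroup V] [Module ℂ V] [Module (Uq b c ħ) V] [IsScalarTower ℂ (Uq b c ħ) V]
  {M : Type*} [AddCommGroup M] [Module ℂ M] [Module (Uq b c ħ) M] [IsScalarTower ℂ (Uq b c ħ) M]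

/-! ### Leading coefficients. -/

section LeadingCoeff

omit [Module (Uq b c ħ) V] [IsScalarTower ℂ (Uq b c ħ) V]

variable {zeta : Module.Dual ℂ H} {m : M}

theorem isLeadingCoeff_zero : IsLeadingCoeff b c ħ zeta m (0 : V ⊗[ℂ] M) (0 : V) := by
  simp [IsLeadingCoeff]

theorem IsLeadingCoeff.add {u u' : V ⊗[ℂ] M} {v v' : V} (h : IsLeadingCoeff b c ħ zeta m u v)
    (h' : IsLeadingCoeff b c ħ zeta m u' v') :
    IsLeadingCoeff b c ħ zeta m (u + u') (v + v') := by
  unfold IsLeadingCoeff at *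
  rw [TensorProduct.add_tmul, add_sub_add_comm]
  exact add_mem h h'

theorem IsLeadingCoeff.smul {u : V ⊗[ℂ] M} {v : V} (a : ℂ)
    (h : IsLeadingCoeff b c ħ zeta m u v) : IsLeadingCoeff b c ħ zeta m (a • u) (a • v) := by
  unfold IsLeadingCoeff at *
  rw [← TensorProduct.smul_tmul', ← smul_sub]
  exact Submodule.smul_mem _ a h

theorem IsHighestCyclic.exists_isLeadingCoeff (hm : IsHighestCyclic b c ħ zeta m)
    (u : V ⊗[ℂ] M) : ∃ v, IsLeadingCoeff b c ħ zeta m u v := by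
  induction u using TensorProduct.induction_on with
  | zero => exact ⟨0, isLeadingCoeff_zero⟩
  | tmul v w =>
    obtain ⟨x, hx, y, hy, rfl⟩ := Submodule.mem_sup.mp (hm.mem_span_sup_lowerPart w).1
    obtain ⟨a, rfl⟩ := Submodule.mem_span_singleton.mp hx
    refine ⟨a • v, v ⊗ₜ ⟨y, hy⟩, ?_⟩
    rw [LinearMap.lTensor_tmul, Submodule.subtype_apply, TensorProduct.tmul_add,
      TensorProduct.tmul_smul, TensorProduct.smul_tmul', add_sub_cancel_left]
  | add u u' h h' =>
    obtain ⟨v, hv⟩ := h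
    obtain ⟨v', hv'⟩ := h'
    exact ⟨v + v', hv.add hv'⟩

end LeadingCoeff

/-! ### Transport along a module map `M → M'`. -/

section Functoriality

variable {M' : Type*} [AddCommGroup M'] [Module ℂ M'] [Module (Uq b c ħ) M']
  [IsScalarTower ℂ (Uq b c ħ) M'] (φ : M →ₗ[Uq b c ħ] M')

theorem tensorE_lTensor (i : b.support) (u : V ⊗[ℂ] M) :
    tensorE b c ħ i (LinearMap.lTensor V (φ.restrictScalars ℂ) u) =
      LinearMap.lTensor V (φ.restrictScalars ℂ) (tensorE b c ħ i u) := by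
  induction u using TensorProduct.induction_on with
  | zero => simp
  | tmul v z => simp [tensorE]
  | add x y hx hy => simp only [map_add, hx, hy]

theorem tensorK_lTensor (i : b.support) (u : V ⊗[ℂ] M) :
    tensorK b c ħ i (LinearMap.lTensor V (φ.restrictScalars ℂ) u) =
      LinearMap.lTensor V (φ.restrictScalars ℂ) (tensorK b c ħ i u) := by
  induction u using TensorProduct.induction_on with
  | zero => simp
  | tmul v z => simp [tensorK]
  | add x y hx hy => simp only [map_add, hx, hy]

theorem tensorE_of_mem_singularSpan {u : V ⊗[ℂ] M} (hu : u ∈ singularSpan b c ħ V M)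
    (i : b.support) : tensorE b c ħ i u = 0 :=
  (Submodule.span_le.mpr fun _ hw => hw.2.2 i :
    singularSpan b c ħ V M ≤ LinearMap.ker (tensorE b c ħ i)) hu

theorem lTensor_mem_singularSpan {u : V ⊗[ℂ] M} (hu : u ∈ singularSpan b c ħ V M) :
    LinearMap.lTensor V (φ.restrictScalars ℂ) u ∈ singularSpan b c ħ V M' := by
  refine (Submodule.span_le.mpr ?_ : singularSpan b c ħ V M ≤ (singularSpan b c ħ V M').comap
    (LinearMap.lTensor V (φ.restrictScalars ℂ))) hu
  rintro w ⟨-, ⟨mu, hmu⟩, hE⟩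
  -- A singular vector may map to zero, which is not singular but lies in the span.
  by_cases h0 : LinearMap.lTensor V (φ.restrictScalars ℂ) w = 0
  · exact (congrArg (· ∈ singularSpan b c ħ V M') h0).mpr (zero_mem _)
  · refine Submodule.subset_span ⟨h0, ⟨mu, fun i => ?_⟩, fun i => ?_⟩
    · rw [tensorK_lTensor, hmu, map_smul]
    · rw [tensorE_lTensor, hE, map_zero]

theorem map_lowerPart_le (zeta : Module.Dual ℂ H) :
    ∀ w ∈ lowerPart b c ħ M zeta, φ w ∈ lowerPart b c ħ M' zeta := by
  refine lowerPart_le (W := (lowerPart b c ħ M' zeta).comap (φ.restrictScalars ℂ))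
    fun beta hb h0 w hw => mem_lowerPart_of_mem_weightSpace hb h0 ?_
  rw [mem_weightSpace] at hw ⊢
  intro i
  change genK c ħ i • φ w = _
  rw [← map_smul, hw, LinearMap.map_smul_of_tower]
  rfl

omit [Module (Uq b c ħ) V] [IsScalarTower ℂ (Uq b c ħ) V] in
theorem IsLeadingCoeff.lTensor {zeta : Module.Dual ℂ H} {m : M} {u : V ⊗[ℂ] M} {v : V}
    (h : IsLeadingCoeff b c ħ zeta m u v) :
    IsLeadingCoeff b c ħ zeta (φ m) (LinearMap.lTensor V (φ.restrictScalars ℂ) u) v := by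
  obtain ⟨t, ht⟩ := h
  refine ⟨LinearMap.lTensor V ((φ.restrictScalars ℂ).restrict (map_lowerPart_le φ zeta)) t, ?_⟩
  have h1 : LinearMap.lTensor V (φ.restrictScalars ℂ) (u - v ⊗ₜ m) =
      LinearMap.lTensor V (φ.restrictScalars ℂ) u - v ⊗ₜ φ m := by
    rw [map_sub, LinearMap.lTensor_tmul]
    rfl
  rw [← h1, ← ht, ← LinearMap.lTensor_comp_apply, ← LinearMap.lTensor_comp_apply]
  rfl

omit [Module (Uq b c ħ) V] [IsScalarTower ℂ (Uq b c ħ) V] in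
theorem lTensor_present (m : M) (t : V ⊗[ℂ] Uminus b c ħ) :
    LinearMap.lTensor V (φ.restrictScalars ℂ) (present b c ħ m t) = present b c ħ (φ m) t := by
  rw [present, ← LinearMap.lTensor_comp_apply, present]
  congr 2
  ext x
  exact map_smul φ x.1 m

end Functoriality

/-! ### Existence of singular vectors and of the twist. -/

section Existence

variable {zeta : Module.Dual ℂ H} {m : M}

theorem genK_mul_mul_genKinv_mem_Uminus (i : b.support) {x : Uq b c ħ} (hx : x ∈ Uminus b c ħ) :
    genK c ħ i * x * genKinv c ħ i ∈ Uminus b c ħ := by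
  induction hx using Algebra.adjoin_induction with
  | mem x hx =>
    obtain ⟨j, rfl⟩ := hx
    rw [K_mul_F, smul_mul_assoc, mul_assoc, K_mul_Kinv, mul_one]
    exact Subalgebra.smul_mem _ (Algebra.subset_adjoin (Set.mem_range_self j)) _
  | algebraMap a =>
    rw [← Algebra.commutes, mul_assoc, K_mul_Kinv, mul_one]
    exact Subalgebra.algebraMap_mem _ a
  | add x y _ _ hx hy => rw [mul_add, add_mul]; exact add_mem hx hy
  | mul x y _ _ hx hy =>
    have h : genK c ħ i * (x * y) * genKinv c ħ i =
        genK c ħ i * x * genKinv c ħ i * (genK c ħ i * y * genKinv c ħ i) := by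
      calc genK c ħ i * (x * y) * genKinv c ħ i
          = genK c ħ i * x * 1 * y * genKinv c ħ i := by simp only [mul_one, mul_assoc]
        _ = _ := by rw [← Kinv_mul_K c ħ i]; simp only [mul_assoc]
    rw [h]
    exact mul_mem hx hy

/-- As `m` is a torus eigenvector, `I⁻` is stable under conjugation by `q^{h_α}`, and `σ` carries
this to the inverse conjugation. Stability lets `V⁺_Z` be spanned by weight vectors. -/
theorem genK_smul_mem_extremalSubspace (hm : IsHighestCyclic b c ħ zeta m) (i : b.support)
    {v : V} (hv : v ∈ extremalSubspace b c ħ V m) :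
    genK c ħ i • v ∈ extremalSubspace b c ħ V m := by
  rintro _ ⟨x, hx, rfl⟩
  change sigma c ħ x • genK c ħ i • v = 0
  have h1 : genK c ħ i * x * genKinv c ħ i ∈ annMinus b c ħ m := by
    refine ⟨genK_mul_mul_genKinv_mem_Uminus i hx.1, ?_⟩
    rw [mul_smul, mul_smul,
      genKinv_smul_of_genK_smul (char_ne_zero b c ħ zeta i) (hm.genK_smul i), smul_comm x, hx.2,
      smul_zero, smul_zero]
  have h2 : sigma c ħ (genK c ħ i * x * genKinv c ħ i) • v = 0 := hv _ ⟨_, h1, rfl⟩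
  have h3 : sigma c ħ (genK c ħ i * x * genKinv c ħ i) =
      genKinv c ħ i * sigma c ħ x * genK c ħ i := by
    rw [map_mul, map_mul]
    exact congrArg₂ _ (congrArg (· * _) (sigma_quot c ħ (Gen.K i)))
      (sigma_quot c ħ (Gen.Kinv i))
  rw [h3, mul_smul, mul_smul] at h2
  have h4 := congrArg (genK c ħ i • ·) h2
  simpa only [← mul_smul, ← mul_assoc, K_mul_Kinv, one_mul, smul_zero] using h4

theorem exists_mem_singularSpan_of_weight [IsSimpleModule (Uq b c ħ) M]
    (hm : IsHighestCyclic b c ħ zeta m) {ε : M →ₗ[ℂ] ℂ} (hε : IsHighestCoeff b c ħ zeta m ε)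
    {nu : Module.Dual ℂ H} {v₀ : V} (hV : IsHighestCyclic b c ħ nu v₀) {v : V}
    (hv : v ∈ extremalSubspace b c ħ V m) {mu : Module.Dual ℂ H}
    (hmu : v ∈ weightSpace b c ħ V mu) :
    ∃ u ∈ singularSpan b c ħ V M, IsLeadingCoeff b c ħ zeta m u v := by
  obtain ⟨B, hB⟩ := hε.exists_form hm
  have hinj := form_injective hm hε hB
  obtain ⟨ψ, hψv, hψ⟩ := exists_intertwiner hm hv
  obtain ⟨N, hN⟩ := hV.exists_mem_nilpotentPart v
  obtain ⟨u, hu⟩ := exists_pairing_eq hm hε hB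
    fun n hn z hz => intertwiner_layer_eq_zero hψ (hψv.symm ▸ hN) hn hz
  have hE : ∀ i, tensorE b c ħ i u = 0 := fun i =>
    pairing_injective hinj (LinearMap.ext fun w => by
      rw [pairing_tensorE hm hB, hu, hψ, sub_self, LinearMap.zero_apply])
  have hK : ∀ i, tensorK b c ħ i u = char b c ħ (mu + zeta) i • u := by
    intro i
    rw [← sub_eq_zero]
    refine pairing_injective hinj (LinearMap.ext fun w => ?_)
    rw [map_sub, map_smul, LinearMap.sub_apply, LinearMap.smul_apply, pairing_tensorK hm hB, hu,
      LinearMap.zero_apply]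
    -- The weight identity holds at `m` and propagates along the `f_j`: the powers of `q` from
    -- moving `q^{h_i}` past `f_j` and past `e_j` are inverse to each other.
    refine hm.mem_of_genF (W := LinearMap.ker
      (Algebra.lsmul ℂ ℂ V (genK c ħ i) ∘ₗ ψ ∘ₗ Algebra.lsmul ℂ ℂ M (genK c ħ i) -
        char b c ħ (mu + zeta) i • ψ)) ?_ (fun j w hw => ?_) w
    · change genK c ħ i • ψ (genK c ħ i • m) - char b c ħ (mu + zeta) i • ψ m = 0
      rw [hm.genK_smul, map_smul, smul_comm, hψv, mem_weightSpace.mp hmu, smul_smul, char_add,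
        Pi.mul_apply, mul_comm, sub_self]
    · change genK c ħ i • ψ (genK c ħ i • w) - char b c ħ (mu + zeta) i • ψ w = 0 at hw
      change genK c ħ i • ψ (genK c ħ i • genF c ħ j • w) -
        char b c ħ (mu + zeta) i • ψ (genF c ħ j • w) = 0
      rw [← mul_smul, K_mul_F, smul_assoc, mul_smul, map_smul, hψ, hψ, smul_comm (genK c ħ i),
        ← mul_smul (genK c ħ i), K_mul_E, smul_assoc, mul_smul, smul_smul,
        mul_comm (qpow ħ _), qpow_mul_neg, one_smul, sub_eq_zero.mp hw, smul_comm, sub_self]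
  have hu' : u ∈ singularSpan b c ħ V M := by
    by_cases h0 : u = 0
    · exact h0 ▸ zero_mem _
    · exact Submodule.subset_span ⟨h0, ⟨_, hK⟩, hE⟩
  obtain ⟨v', hv'⟩ := hm.exists_isLeadingCoeff u
  have h1 := pairing_apply_of_isLeadingCoeff hm hε hB hv'
  rw [hu, hψv] at h1
  exact ⟨u, hu', h1 ▸ hv'⟩

theorem exists_mem_singularSpan [IsSimpleModule (Uq b c ħ) M]
    (hm : IsHighestCyclic b c ħ zeta m) {ε : M →ₗ[ℂ] ℂ} (hε : IsHighestCoeff b c ħ zeta m ε)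
    {nu : Module.Dual ℂ H} {v₀ : V} (hV : IsHighestCyclic b c ħ nu v₀) {v : V}
    (hv : v ∈ extremalSubspace b c ħ V m) :
    ∃ u ∈ singularSpan b c ħ V M, IsLeadingCoeff b c ħ zeta m u v := by
  have h := le_span_weight_vectors hV.iSup_weightSpace
    (fun i w hw => genK_smul_mem_extremalSubspace hm i hw) hv
  clear hv
  induction h using Submodule.span_induction with
  | mem v hv =>
    obtain ⟨hv, mu, hmu⟩ := hv
    exact exists_mem_singularSpan_of_weight hm hε hV hv hmu
  | zero => exact ⟨0, zero_mem _, isLeadingCoeff_zero⟩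
  | add x y _ _ hx hy =>
    obtain ⟨u, hu, hux⟩ := hx
    obtain ⟨w, hw, hwy⟩ := hy
    exact ⟨u + w, add_mem hu hw, hux.add hwy⟩
  | smul a x _ hx =>
    obtain ⟨u, hu, hux⟩ := hx
    exact ⟨a • u, Submodule.smul_mem _ a hu, hux.smul a⟩

theorem contract_tmul (v : V) (x : Uminus b c ħ) :
    contract b c ħ V (v ⊗ₜ x) = invAntipode c ħ x.1 • v := rfl

omit [Module (Uq b c ħ) V] [IsScalarTower ℂ (Uq b c ħ) V] in
theorem present_surjective (hm : IsHighestCyclic b c ħ zeta m) :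
    Function.Surjective (present (V := V) b c ħ m) :=
  LinearMap.lTensor_surjective V fun w => by
    obtain ⟨x, hx, hxw⟩ := hm.exists_Uminus_smul w
    exact ⟨⟨x, hx⟩, hxw⟩

/-- The class of `∑ γ⁻¹(f_i) v_i` depends on `∑ v_i ⊗ f_i m` only. -/
theorem contract_mem_perpSubspace (hm : IsHighestCyclic b c ħ zeta m) {t : V ⊗[ℂ] Uminus b c ħ}
    (ht : present b c ħ m t = 0) : contract b c ħ V t ∈ perpSubspace b c ħ V m := by
  let g : Uminus b c ħ →ₗ[ℂ] M := orbitMap b c ħ m ∘ₗ (Uminus b c ħ).val.toLinearMap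
  have hg : Function.Surjective g := fun w => by
    obtain ⟨x, hx, hxw⟩ := hm.exists_Uminus_smul w
    exact ⟨⟨x, hx⟩, hxw⟩
  -- By right exactness `t` comes from `V ⊗ I⁻`, and for `x` in `I⁻` one has `γ⁻¹(x) = ω(σ(x))` with
  -- `σ(x)` in `I⁺`.
  obtain ⟨s, rfl⟩ := (lTensor_exact V g.exact_subtype_ker_map hg t).mp ht
  clear ht
  induction s using TensorProduct.induction_on with
  | zero => simp
  | tmul v x =>
    refine Submodule.subset_span ⟨sigma c ħ x.1.1, ⟨x.1.1, ⟨x.1.2, x.2⟩, rfl⟩, v, ?_⟩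
    rw [LinearMap.lTensor_tmul, contract_tmul]
    change _ = invAntipode c ħ (sigma c ħ (sigma c ħ x.1.1)) • v
    rw [sigma_sigma]
    rfl
  | add x y hx hy => rw [map_add, map_add]; exact add_mem hx hy

/-- The pairs (presentation, leading coefficient) form a linear space `S`. Projection to the
coefficient is onto by `hP`, and by `hN` the contraction modulo `N` vanishes on its kernel, so it
factors through `P`. -/
theorem exists_isExtremalTwist (hm : IsHighestCyclic b c ħ zeta m) (P N : Submodule ℂ V)
    (hP : ∀ v ∈ P, ∃ u ∈ singularSpan b c ħ V M, IsLeadingCoeff b c ħ zeta m u v)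
    (hN : ∀ t : V ⊗[ℂ] Uminus b c ħ, present b c ħ m t ∈ singularSpan b c ħ V M →
      IsLeadingCoeff b c ħ zeta m (present b c ħ m t) 0 → contract b c ħ V t ∈ N) :
    ∃ θ : P →ₗ[ℂ] V ⧸ N, IsExtremalTwist b c ħ zeta m P N θ := by
  let S : Submodule ℂ ((V ⊗[ℂ] Uminus b c ħ) × P) :=
    { carrier := {p | present b c ħ m p.1 ∈ singularSpan b c ħ V M ∧
        IsLeadingCoeff b c ħ zeta m (present b c ħ m p.1) (p.2 : V)}
      add_mem' := fun hx hy => ⟨by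
        rw [Prod.fst_add, map_add]; exact add_mem hx.1 hy.1, by
        rw [Prod.fst_add, map_add]; exact hx.2.add hy.2⟩
      zero_mem' := ⟨by rw [Prod.fst_zero, map_zero]; exact zero_mem _, by
        rw [Prod.fst_zero, map_zero]; exact isLeadingCoeff_zero⟩
      smul_mem' := fun a x hx => ⟨by
        rw [Prod.smul_fst, map_smul]; exact Submodule.smul_mem _ a hx.1, by
        rw [Prod.smul_fst, map_smul]; exact hx.2.smul a⟩ }
  obtain ⟨θ, hθ⟩ := exists_factor_of_ker_le (LinearMap.snd ℂ _ _ ∘ₗ S.subtype)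
    (fun v => by
      obtain ⟨u, hu, huv⟩ := hP v.1 v.2
      obtain ⟨t, rfl⟩ := present_surjective (V := V) hm u
      exact ⟨⟨(t, v), hu, huv⟩, rfl⟩)
    (N.mkQ ∘ₗ contract b c ħ V ∘ₗ LinearMap.fst ℂ _ _ ∘ₗ S.subtype)
    (by
      rintro ⟨⟨t, v⟩, h1, h2⟩ h0
      obtain rfl : v = 0 := h0
      exact (Submodule.Quotient.mk_eq_zero N).mpr (hN t h1 h2))
  have hθ' : ∀ (t : V ⊗[ℂ] Uminus b c ħ) (v : P),
      present b c ħ m t ∈ singularSpan b c ħ V M →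
      IsLeadingCoeff b c ħ zeta m (present b c ħ m t) (v : V) →
      θ v = N.mkQ (contract b c ħ V t) := fun t v h1 h2 => hθ ⟨(t, v), h1, h2⟩
  refine ⟨θ, fun v w => ⟨?_, ?_⟩⟩
  · rintro rfl
    obtain ⟨u, hu, huv⟩ := hP v.1 v.2
    obtain ⟨t, rfl⟩ := present_surjective (V := V) hm u
    exact ⟨t, hu, huv, hθ' t v hu huv⟩
  · rintro ⟨t, h1, h2, rfl⟩
    exact hθ' t v h1 h2

end Existence

end Twist

end QuantumTwist

theorem mainTheorem7
    {𝔤 : Type*} [LieRing 𝔤] [LieAlgebra ℂ 𝔤] [FiniteDimensional ℂ 𝔤]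
    [LieAlgebra.IsSemisimple ℂ 𝔤] {H : LieSubalgebra ℂ 𝔤} [H.IsCartanSubalgebra]
    (b : (LieAlgebra.IsKilling.rootSystem H).Base) (c : ℚ) (hc : 0 < c)
    (ħ : ℂ) (hq : ∀ n : ℕ, 0 < n → Complex.exp ħ ^ n ≠ 1)
    {V : Type*} [AddCommGroup V] [Module ℂ V] [Module (Uq b c ħ) V]
    [IsScalarTower ℂ (Uq b c ħ) V] [IsSimpleModule (Uq b c ħ) V]
    {Z : Type*} [AddCommGroup Z] [Module ℂ Z] [Module (Uq b c ħ) Z]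
    [IsScalarTower ℂ (Uq b c ħ) Z] [IsSimpleModule (Uq b c ħ) Z]
    (nu zeta : Module.Dual ℂ H) (v₀ : V) (z₀ : Z)
    (hV : IsHighestWeight b c ħ nu v₀) (hZ : IsHighestWeight b c ħ zeta z₀)
    (hlift : ∀ u : V ⊗[ℂ] Z, IsSingular b c ħ u →
      ∃ u' : V ⊗[ℂ] Verma b c ħ zeta, IsSingular b c ħ u' ∧
        LinearMap.lTensor V ((vermaProj b c ħ hZ).restrictScalars ℂ) u' = u) :
    ∃ h : extremalSubspace b c ħ V z₀ = vermaExtremalSubspace b c ħ V zeta,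
    ∃ θ : extremalSubspace b c ħ V z₀ →ₗ[ℂ] V ⧸ perpSubspace b c ħ V z₀,
    ∃ θ' : vermaExtremalSubspace b c ħ V zeta →ₗ[ℂ] V ⧸ perpSubspace b c ħ V z₀,
      IsExtremalTwist b c ħ zeta z₀ _ _ θ ∧
      IsExtremalTwist b c ħ zeta (vermaVec b c ħ zeta) _ _ θ' ∧
      θ = θ' ∘ₗ (LinearEquiv.ofEq _ _ h).toLinearMap := by
  have hm := hZ.isHighestCyclic
  have hM := isHighestCyclic_vermaVec b c ħ zeta
  obtain ⟨ε, hε⟩ := hZ.exists_isHighestCoeff hc hq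
  obtain ⟨B, hB⟩ := hε.exists_form hm
  let π := vermaProj b c ħ hZ
  have hπ : π (vermaVec b c ħ zeta) = z₀ := vermaProj_vermaVec b c ħ hZ
  have hlead : ∀ {u : V ⊗[ℂ] Verma b c ħ zeta} {v : V},
      IsLeadingCoeff b c ħ zeta (vermaVec b c ħ zeta) u v →
      IsLeadingCoeff b c ħ zeta z₀ (LinearMap.lTensor V (π.restrictScalars ℂ) u) v :=
    fun h => hπ ▸ h.lTensor π
  have hpres : ∀ t : V ⊗[ℂ] Uminus b c ħ, LinearMap.lTensor V (π.restrictScalars ℂ)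
      (present b c ħ (vermaVec b c ħ zeta) t) = present b c ħ z₀ t :=
    fun t => hπ ▸ lTensor_present π _ t
  -- The same `t` presents a vector over the Verma module and its image over `Z`, so both recipes
  -- contract the same tensor.
  have hdesc : ∀ (t : V ⊗[ℂ] Uminus b c ħ) (v : V),
      present b c ħ (vermaVec b c ħ zeta) t ∈ singularSpan b c ħ V (Verma b c ħ zeta) →
      IsLeadingCoeff b c ħ zeta (vermaVec b c ħ zeta)
        (present b c ħ (vermaVec b c ħ zeta) t) v →
      present b c ħ z₀ t ∈ singularSpan b c ħ V Z ∧
        IsLeadingCoeff b c ħ zeta z₀ (present b c ħ z₀ t) v :=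
    fun t v h1 h2 => hpres t ▸ ⟨lTensor_mem_singularSpan π h1, hlead h2⟩
  have hvanish : ∀ t : V ⊗[ℂ] Uminus b c ħ, present b c ħ z₀ t ∈ singularSpan b c ħ V Z →
      IsLeadingCoeff b c ħ zeta z₀ (present b c ħ z₀ t) 0 →
      contract b c ħ V t ∈ perpSubspace b c ħ V z₀ := fun t h1 h2 =>
    contract_mem_perpSubspace hm
      (eq_zero_of_isLeadingCoeff_zero hm hε hB (tensorE_of_mem_singularSpan h1) h2)
  have hex : ∀ v ∈ extremalSubspace b c ħ V z₀, ∃ u ∈ singularSpan b c ħ V Z,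
      IsLeadingCoeff b c ħ zeta z₀ u v :=
    fun v hv => exists_mem_singularSpan hm hε hV.isHighestCyclic hv
  have hex' : ∀ v ∈ vermaExtremalSubspace b c ħ V zeta,
      ∃ u ∈ singularSpan b c ħ V (Verma b c ħ zeta),
        IsLeadingCoeff b c ħ zeta (vermaVec b c ħ zeta) u v := by
    intro v hv
    induction hv using Submodule.span_induction with
    | mem v hv =>
      obtain ⟨u, hu, huv⟩ := hv
      exact ⟨u, Submodule.subset_span hu, huv⟩
    | zero => exact ⟨0, zero_mem _, isLeadingCoeff_zero⟩
    | add x y _ _ hx hy =>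
      obtain ⟨u, hu, hux⟩ := hx
      obtain ⟨w, hw, hwy⟩ := hy
      exact ⟨u + w, add_mem hu hw, hux.add hwy⟩
    | smul a x _ hx =>
      obtain ⟨u, hu, hux⟩ := hx
      exact ⟨a • u, Submodule.smul_mem _ a hu, hux.smul a⟩
  -- The lifting hypothesis enters here, extended from singular vectors to their span.
  have hsing : ∀ u ∈ singularSpan b c ħ V Z, ∃ v ∈ vermaExtremalSubspace b c ħ V zeta,
      IsLeadingCoeff b c ħ zeta z₀ u v := by
    intro u hu
    induction hu using Submodule.span_induction with
    | mem u hu =>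
      obtain ⟨u', hu', rfl⟩ := hlift u hu
      obtain ⟨v, hv⟩ := hM.exists_isLeadingCoeff u'
      exact ⟨v, Submodule.subset_span ⟨u', hu', hv⟩, hlead hv⟩
    | zero => exact ⟨0, zero_mem _, isLeadingCoeff_zero⟩
    | add x y _ _ hx hy =>
      obtain ⟨v, hv, hvx⟩ := hx
      obtain ⟨w, hw, hwy⟩ := hy
      exact ⟨v + w, add_mem hv hw, hvx.add hwy⟩
    | smul a x _ hx =>
      obtain ⟨v, hv, hvx⟩ := hx
      exact ⟨a • v, Submodule.smul_mem _ a hv, hvx.smul a⟩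
  have h : extremalSubspace b c ħ V z₀ = vermaExtremalSubspace b c ħ V zeta := by
    refine le_antisymm (fun v hv => ?_) (Submodule.span_le.mpr ?_)
    · obtain ⟨u, hu, huv⟩ := hex v hv
      obtain ⟨w, hw, huw⟩ := hsing u hu
      -- Uniqueness of leading coefficients over `Z` identifies `w` with `v`.
      rwa [← pairing_apply_of_isLeadingCoeff hm hε hB huv,
        pairing_apply_of_isLeadingCoeff hm hε hB huw]
    · rintro v ⟨u, hu, huv⟩
      exact mem_extremalSubspace_of_isLeadingCoeff hm hε hB (tensorE_of_mem_singularSpan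
        (lTensor_mem_singularSpan π (Submodule.subset_span hu))) (hlead huv)
  obtain ⟨θ, hθ⟩ := exists_isExtremalTwist hm (extremalSubspace b c ħ V z₀)
    (perpSubspace b c ħ V z₀) hex hvanish
  -- No non-degeneracy is needed for the Verma module: it suffices that a vector with zero leading
  -- coefficient has zero image in `V ⊗ Z`, since classes are taken modulo `V^⊥_Z`.
  obtain ⟨θ', hθ'⟩ := exists_isExtremalTwist hM (vermaExtremalSubspace b c ħ V zeta)
    (perpSubspace b c ħ V z₀) hex' fun t h1 h2 =>
      hvanish t (hdesc t 0 h1 h2).1 (hdesc t 0 h1 h2).2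
  refine ⟨h, θ, θ', hθ, hθ', LinearMap.ext fun v => ?_⟩
  -- A presentation that computes `θ'` at `v` also computes `θ` at `v`.
  obtain ⟨t, h1, h2, h3⟩ := (hθ' (LinearEquiv.ofEq _ _ h v) _).mp rfl
  exact (hθ v _).mpr ⟨t, (hdesc t v h1 h2).1, (hdesc t v h1 h2).2, h3⟩
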